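/- **Setting.** Let $k$ be a field with $\mathbb{Q}\subseteq k$, $C$ a $k$-coalgebra with coproduct $\Delta(c)=c_{(1)}\otimes c_{(2)}$, and $P$ a unital $k$-algebra which is a right $C$-comodule via a $k$-linear coaction $\Delta_P:P\to P\otimes C$. Put $B=P^{co\,C}=\{b\in P\mid \Delta_P(bp)=b\,\Delta_P(p)\ \forall p\in P\}$. Assume that $B\subseteq P$ is a *principal $C$-extension*, i.e. 1. $can:P\otimes_BP\to P\otimes C$, $p\otimes_B q\mapsto p\,\Delta_P(q)$, is bijective; 2. $\psi:C\otimes P\to P\otimes C$, $\psi(c\otimes p)=can(can^{-1}(1\otimes c)\,p)$, is bijective; 3. there is a group-like $e\in C$ with $\Delta_P(p)=\psi(e\otimes p)$ for all $p\in P$; such an $e$ is fixed; 4. $P$ is $C$-equivariantly projective as a left $B$-module: for left $B$-modules and right $C$-comodules $M,N$ with $B$-linear coactions, every $B$-linear $C$-colinear map $P\to N$ lifts through every $B$-linear $C$-colinear surjection $M\to N$ that is split as a $C$-comodule map. A *strong connection* is a linear map $\ell:C\to P\otimes P$, written $\ell(c)=c^{<1>}\otimes c^{<2>}$, such that the class of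 $\ell(c)$ in $P\otimes_BP$ is $can^{-1}(1\otimes c)$, $({\rm id}\otimes\Delta_P)\circ\ell=(\ell\otimes{\rm id})\circ\Delta$, $({}_P\Delta\otimes{\rm id})\circ\ell=({\rm id}\otimes\ell)\circ\Delta$ with ${}_P\Delta(p)=\psi^{-1}(p\otimes e)$, and $\ell(e)=1\otimes1$. Let $R_f(C)$ be the Grothendieck group of the monoid (under $\oplus$) of isomorphism classes of finite-dimensional right $C$-comodules $\phi:V_\phi\to V_\phi\otimes C$, and $K_0(B)$ the Grothendieck group of finitely generated projective left $B$-modules. For a basis $(e_i)$ of $V_\phi$ with $\phi(e_j)=\sum_i e_i\otimes e_{ij}$ put $c_\phi=\sum_i e_{ii}\in C$. Let $HC_*(B)$ be the cyclic homology of $B$ over $k$, computed by Connes' complex $B^{\otimes(m+1)}/(1-t)$, where $t(a_0\otimes\cdots\otimes a_m)=(-1)^m a_m\otimes a_0\otimes\cdots\otimes a_{m-1}$, with the Hochschild boundary. Let $ch_{2n}:K_0(B)\to HC_{2n}(B)$ be the Chern character, which sends the class of the left module $B^NE$, with $E\in M_N(B)$ idempotent, to $$(-1)^n\Big[\sum_{i_0,\dots,i_{2n}}E_{i_0i_1}\otimes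 E_{i_1i_2}\otimes\cdots\otimes E_{i_{2n}i_0}\Big].$$ **Statement.** Strong connections exist. For every finite-dimensional corepresentation $\phi$ the left $B$-module ${\rm Hom}^C(V_\phi,P)$ of colinear maps is finitely generated projective, and $[\phi]\mapsto[{\rm Hom}^C(V_\phi,P)]$ defines a homomorphism of abelian groups $R_f(C)\to K_0(B)$. Let $chg_{2n}:R_f(C)\to HC_{2n}(B)$ be its composition with $ch_{2n}$. Then for every $n\in\mathbb{N}$, every $\phi$, every basis of $V_\phi$ and every strong connection $\ell$, the element $$z={c_{\phi(2n+1)}}^{<2>}{c_{\phi(1)}}^{<1>}\otimes{c_{\phi(1)}}^{<2>}{c_{\phi(2)}}^{<1>}\otimes\cdots\otimes{c_{\phi(2n)}}^{<2>}{c_{\phi(2n+1)}}^{<1>}\in P^{\otimes(2n+1)}$$ lies in (the image of) $B^{\otimes(2n+1)}$, represents a cycle of Connes' complex of $B$, and $$chg_{2n}([\phi])=(-1)^n[z]\in HC_{2n}(B).$$ In particular the class $[z]$ does not depend on the choice of $\ell$ (nor of the basis). -/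

import Mathlib

open scoped TensorProduct Matrix

universe uk uC uP u v w

namespace ChernGalois

set_option linter.unusedSectionVars false

section Cyclic

/-- The tensor power `A^{⊗ m}` over `k`. -/
abbrev Tens (k A : Type*) [Field k] [Ring A] [Algebra k A] (m : ℕ) : Type _ :=
  PiTensorProduct k (fun _ : Fin m => A)

/-- The tuple `(a₀, …, aᵢ aᵢ₊₁, …, aₘ₊₁)`. -/
def faceFun {A : Type*} [Mul A] {m : ℕ} (i : Fin (m + 1)) (a : Fin (m + 2) → A) :
    Fin (m + 1) → A :=
  fun j => if j < i then a j.castSucc else if j = i then a j.castSucc * a j.succ else a j.succ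

variable (k : Type*) [Field k] (A : Type*) [Ring A] [Algebra k A]

theorem faceFun_update {A : Type*} [Mul A] {m : ℕ} (i : Fin (m + 1)) (a : Fin (m + 2) → A)
    (p : Fin (m + 2)) (x : A) :
    faceFun i (Function.update a p x) =
      Function.update (faceFun i a) (i.predAbove p)
        (if p = i.castSucc then x * a i.succ else if p = i.succ then a i.castSucc * x else x) := by
  funext j
  by_cases hj : j = i.predAbove p
  · subst hj
    rw [Function.update_self]
    rcases lt_trichotomy p i.castSucc with h | h | h
    · have h1 : i.predAbove p = p.castPred (Fin.ne_last_of_lt h) :=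
        Fin.predAbove_of_le_castSucc _ _ h.le
      have h2 : i.predAbove p < i := by rw [h1]; exact h
      have h3 : p ≠ i.castSucc := h.ne
      have h4 : p ≠ i.succ := (h.trans Fin.castSucc_lt_succ).ne
      have h5 : (i.predAbove p).castSucc = p := by rw [h1]; simp
      simp [faceFun, h2, h3, h4, h5]
    · subst h
      have : i.predAbove i.castSucc = i := by simp
      rw [this]
      simp [faceFun, Function.update_of_ne (Fin.castSucc_lt_succ (i := i)).ne']
    · have h1 : i.predAbove p = p.pred (Fin.ne_zero_of_lt h) := Fin.predAbove_of_castSucc_lt _ _ h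
      have h5 : (i.predAbove p).succ = p := by rw [h1]; simp
      rcases eq_or_ne p i.succ with h6 | h6
      · have h2 : i.predAbove p = i := by rw [h1]; simp [h6]
        have h7 : p ≠ i.castSucc := h.ne'
        rw [h2]
        subst h6
        simp [faceFun, h7, Function.update_of_ne h7.symm]
      · have h8 : i < i.predAbove p := by
          have : i.succ < p := lt_of_le_of_ne (Fin.castSucc_lt_iff_succ_le.1 h) h6.symm
          rw [← h5] at this
          simpa using this
        simp [faceFun, h8.not_gt, h8.ne', h.ne', h6, h5]
  · rw [Function.update_of_ne hj]
    have hj1 : ∀ j : Fin (m + 1), j ≠ i.predAbove p → j ≤ i → j.castSucc ≠ p := by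
      rintro j hj hi rfl
      exact hj (Fin.predAbove_castSucc_of_le _ _ hi).symm
    have hj2 : ∀ j : Fin (m + 1), j ≠ i.predAbove p → i ≤ j → j.succ ≠ p := by
      rintro j hj hi rfl
      exact hj (Fin.predAbove_succ_of_le _ _ hi).symm
    rcases lt_trichotomy j i with h | h | h
    · simp [faceFun, h, Function.update_of_ne (hj1 j hj h.le)]
    · subst h
      simp [faceFun, Function.update_of_ne (hj1 j hj le_rfl),
        Function.update_of_ne (hj2 j hj le_rfl)]
    · simp [faceFun, h.not_gt, h.ne', Function.update_of_ne (hj2 j hj h.le)]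

/-- The face map `dᵢ : A^{⊗(m+2)} → A^{⊗(m+1)}` which multiplies the neighbours `aᵢ`, `aᵢ₊₁`. -/
noncomputable def face (m : ℕ) (i : Fin (m + 1)) : Tens k A (m + 2) →ₗ[k] Tens k A (m + 1) :=
  PiTensorProduct.lift
    { toFun := fun a => PiTensorProduct.tprod k (faceFun i a)
      map_update_add' := by
        intro inst a p x y
        obtain rfl : inst = instDecidableEqFin _ := Subsingleton.elim _ _
        simp only [faceFun_update]
        rw [← MultilinearMap.map_update_add]
        congr 2
        split_ifs <;> simp [add_mul, mul_add]
      map_update_smul' := by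
        intro inst a p c x
        obtain rfl : inst = instDecidableEqFin _ := Subsingleton.elim _ _
        simp only [faceFun_update]
        rw [← MultilinearMap.map_update_smul]
        congr 2
        split_ifs <;> simp }

/-- The unsigned rotation `a₀ ⊗ … ⊗ aₘ ↦ aₘ ⊗ a₀ ⊗ … ⊗ aₘ₋₁`. -/
noncomputable def rot (m : ℕ) : Tens k A (m + 1) →ₗ[k] Tens k A (m + 1) :=
  (PiTensorProduct.reindex k (fun _ : Fin (m + 1) => A) (finRotate (m + 1))).toLinearMap

/-- Connes' cyclic operator `t = (-1)^m rot` on `A^{⊗(m+1)}`. -/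
noncomputable def cyc (m : ℕ) : Tens k A (m + 1) →ₗ[k] Tens k A (m + 1) :=
  (-1 : k) ^ m • rot k A m

/-- The Hochschild boundary `b = ∑_{i ≤ m} (-1)^i dᵢ + (-1)^(m+1) d_{m+1}` from `A^{⊗(m+2)}` to
`A^{⊗(m+1)}`; its last face is `a₀ ⊗ … ⊗ aₘ₊₁ ↦ aₘ₊₁ a₀ ⊗ a₁ ⊗ … ⊗ aₘ`. -/
noncomputable def hoch (m : ℕ) : Tens k A (m + 2) →ₗ[k] Tens k A (m + 1) :=
  (∑ i : Fin (m + 1), (-1 : k) ^ (i : ℕ) • face k A m i) +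
    (-1 : k) ^ (m + 1) • (face k A m 0 ∘ₗ rot k A (m + 1))

/-- Chains representing a cycle of Connes' complex, whose degree `m` part is
`A^{⊗(m+1)} / (1 - t)` and whose differential is induced by `b`. -/
noncomputable def cycles : (m : ℕ) → Submodule k (Tens k A (m + 1))
  | 0 => ⊤
  | m + 1 => (LinearMap.range (LinearMap.id - cyc k A m)).comap (hoch k A m)

/-- Chains representing a boundary of Connes' complex. -/
noncomputable def boundaries (m : ℕ) : Submodule k (Tens k A (m + 1)) :=
  LinearMap.range (LinearMap.id - cyc k A m) ⊔ LinearMap.range (hoch k A m)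

/-- Cyclic homology `HC_m(A)`, as the homology of Connes' complex (`k` contains `ℚ`). -/
abbrev HC (m : ℕ) : Type _ := cycles k A m ⧸ (boundaries k A m).submoduleOf (cycles k A m)

/-- The class of a cyclic cycle. -/
noncomputable def HC.mk {m : ℕ} (z : Tens k A (m + 1)) (hz : z ∈ cycles k A m) : HC k A m :=
  Submodule.Quotient.mk ⟨z, hz⟩

variable {k A}

theorem HC.mk_eq_mk {m : ℕ} {z w : Tens k A (m + 1)} (hz : z ∈ cycles k A m)
    (hw : w ∈ cycles k A m) : HC.mk k A z hz = HC.mk k A w hw ↔ z - w ∈ boundaries k A m := by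
  rw [HC.mk, HC.mk, Submodule.Quotient.eq]; rfl

theorem HC.mk_add {m : ℕ} {z w : Tens k A (m + 1)} (hz : z ∈ cycles k A m)
    (hw : w ∈ cycles k A m) :
    HC.mk k A (z + w) (add_mem hz hw) = HC.mk k A z hz + HC.mk k A w hw := rfl

theorem face_tprod {m : ℕ} (i : Fin (m + 1)) (a : Fin (m + 2) → A) :
    face k A m i (PiTensorProduct.tprod k a) = PiTensorProduct.tprod k (faceFun i a) := by
  simp [face]

theorem rot_tprod {m : ℕ} (a : Fin (m + 1) → A) :
    rot k A m (PiTensorProduct.tprod k a) =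
      PiTensorProduct.tprod k (fun j => a ((finRotate (m + 1)).symm j)) := by
  simp [rot, PiTensorProduct.reindex_tprod]

variable {ι : Type*} [Fintype ι]
variable (k)

/-- The generalized trace `(M₀, …, Mₘ) ↦ ∑ M₀(p₀,p₁) ⊗ M₁(p₁,p₂) ⊗ … ⊗ Mₘ(pₘ,p₀)`. -/
noncomputable def genTrace (m : ℕ) :
    MultilinearMap k (fun _ : Fin (m + 1) => Matrix ι ι A) (Tens k A (m + 1)) :=
  ∑ p : Fin (m + 1) → ι,
    (PiTensorProduct.tprod k).compLinearMap fun j => Matrix.entryLinearMap k A (p j) (p (j + 1))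

variable {k}

theorem genTrace_apply {m : ℕ} (M : Fin (m + 1) → Matrix ι ι A) :
    genTrace k m M =
      ∑ p : Fin (m + 1) → ι, PiTensorProduct.tprod k fun j => M j (p j) (p (j + 1)) := by
  simp [genTrace]

theorem rot_genTrace {m : ℕ} (M : Fin (m + 1) → Matrix ι ι A) :
    rot k A m (genTrace k m M) = genTrace k m (fun j => M ((finRotate (m + 1)).symm j)) := by
  rw [genTrace_apply, genTrace_apply, map_sum]
  simp only [rot_tprod]
  refine Fintype.sum_equiv (Equiv.arrowCongr (finRotate (m + 1)) (Equiv.refl ι)) _ _ fun p => ?_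
  congr 1
  funext j
  obtain ⟨j, rfl⟩ := (finRotate (m + 1)).surjective j
  simp

theorem face_genTrace {m : ℕ} (i : Fin (m + 1)) (M : Fin (m + 2) → Matrix ι ι A) :
    face k A m i (genTrace k (m + 1) M) = genTrace k m (faceFun i M) := by
  classical
  rw [genTrace_apply, genTrace_apply, map_sum]
  simp only [face_tprod]
  rw [← (Fin.insertNthEquiv (fun _ => ι) i.succ).sum_comp, Fintype.sum_prod_type_right]
  refine Finset.sum_congr rfl fun q _ => ?_
  have key : ∀ x : ι, faceFun i (fun j => M j ((Fin.insertNthEquiv (fun _ => ι) i.succ (x, q)) j)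
      ((Fin.insertNthEquiv (fun _ => ι) i.succ (x, q)) (j + 1))) =
      Function.update (fun j => faceFun i M j (q j) (q (j + 1))) i
        (M i.castSucc (q i) x * M i.succ x (q (i + 1))) := by
    intro x
    set p : Fin (m + 2) → ι := Fin.insertNthEquiv (fun _ => ι) i.succ (x, q) with hp
    have h0 : p i.succ = x := by simp [hp]
    have h1 : ∀ j : Fin (m + 1), j ≤ i → p j.castSucc = q j := by
      intro j hj
      have : j.castSucc = i.succ.succAbove j :=
        (Fin.succAbove_of_castSucc_lt _ _ (Fin.castSucc_lt_succ_iff.2 hj)).symm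
      rw [this]; simp [hp]
    have h2 : ∀ j : Fin (m + 1), i < j → p j.succ = q j := by
      intro j hj
      have : j.succ = i.succ.succAbove j :=
        (Fin.succAbove_of_le_castSucc _ _ (Fin.succ_le_castSucc_iff.2 hj)).symm
      rw [this]; simp [hp]
    have h3 : ∀ j : Fin (m + 1), j < i → p (j.castSucc + 1) = q (j + 1) := by
      intro j hj
      have hv : ((j + 1 : Fin (m + 1)) : ℕ) = j + 1 :=
        Fin.val_add_one_of_lt (lt_of_lt_of_le hj (Fin.le_last i))
      have e : j.castSucc + 1 = (j + 1).castSucc := by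
        rw [Fin.coeSucc_eq_succ]; ext; simp [hv]
      rw [e, h1]
      rw [Fin.le_def, hv]; exact hj
    have h4 : ∀ j : Fin (m + 1), i ≤ j → p (j.succ + 1) = q (j + 1) := by
      intro j hj
      rcases eq_or_ne j (Fin.last m) with rfl | hl
      · have e : (Fin.last m).succ + 1 = Fin.castSucc 0 := by simp
        rw [e, h1 0 (Fin.zero_le _)]; simp
      · have hv : ((j + 1 : Fin (m + 1)) : ℕ) = j + 1 :=
          Fin.val_add_one_of_lt (Fin.lt_last_iff_ne_last.2 hl)
        have e : j.succ + 1 = (j + 1).succ := by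
          ext
          rw [Fin.val_add_one_of_lt, Fin.val_succ, Fin.val_succ, hv]
          rw [Fin.lt_last_iff_ne_last]
          simpa [← Fin.succ_last] using hl
        rw [e, h2]
        rw [Fin.lt_def, hv]; exact Nat.lt_succ_of_le hj
    funext j
    rcases lt_trichotomy j i with h | h | h
    · rw [Function.update_of_ne h.ne]
      simp only [faceFun, h, if_true]
      rw [h1 j h.le, h3 j h]
    · subst h
      rw [Function.update_self]
      simp only [faceFun, lt_irrefl, if_true, if_false]
      rw [h1 j le_rfl, Fin.coeSucc_eq_succ, h0, h4 j le_rfl]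
    · rw [Function.update_of_ne h.ne']
      simp only [faceFun, h.not_gt, h.ne', if_false]
      rw [h2 j h, h4 j h.le]
  simp only [key]
  rw [← MultilinearMap.map_update_sum]
  congr 1
  conv_rhs => rw [← Function.update_eq_self i fun j => faceFun i M j (q j) (q (j + 1))]
  congr 1
  simp [faceFun, Matrix.mul_apply]

theorem hoch_genTrace {m : ℕ} (M : Fin (m + 2) → Matrix ι ι A) :
    hoch k A m (genTrace k (m + 1) M) =
      (∑ i : Fin (m + 1), (-1 : k) ^ (i : ℕ) • genTrace k m (faceFun i M)) +
        (-1 : k) ^ (m + 1) •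
          genTrace k m (faceFun 0 fun j => M ((finRotate (m + 2)).symm j)) := by
  simp [hoch, face_genTrace, rot_genTrace]

theorem alternating_sum (n : ℕ) : ∑ i : Fin (2 * n + 1), (-1 : k) ^ (i : ℕ) = 1 := by
  rw [Fin.sum_univ_eq_sum_range (fun i => (-1 : k) ^ i) (2 * n + 1), neg_one_geom_sum]
  simp

theorem faceFun_const {R : Type*} [Mul R] {m : ℕ} (i : Fin (m + 1)) {g : R} (hg : g * g = g) :
    faceFun i (fun _ : Fin (m + 2) => g) = fun _ => g := by
  funext j
  simp [faceFun, hg]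

/-- `∑ E(p₀,p₁) ⊗ E(p₁,p₂) ⊗ … ⊗ E(p₂ₙ,p₀)` is a cyclic cycle for an idempotent `E`. -/
theorem genTrace_mem_cycles [CharZero k] {E : Matrix ι ι A} (hE : IsIdempotentElem E) (n : ℕ) :
    genTrace k (2 * n) (fun _ => E) ∈ cycles k A (2 * n) := by
  cases n with
  | zero => exact Submodule.mem_top
  | succ n =>
    change genTrace k (2 * n + 1 + 1) (fun _ => E) ∈
      (LinearMap.range (LinearMap.id - cyc k A (2 * n + 1))).comap (hoch k A (2 * n + 1))
    rw [Submodule.mem_comap, hoch_genTrace]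
    have h1 : ∑ i : Fin (2 * n + 1 + 1), (-1 : k) ^ (i : ℕ) = 0 := by
      rw [Fin.sum_univ_castSucc]
      simp [alternating_sum, pow_add, pow_mul]
    simp only [faceFun_const _ hE.eq, ← Finset.sum_smul, h1]
    refine ⟨(2⁻¹ : k) • genTrace k (2 * n + 1) (fun _ => E), ?_⟩
    simp only [cyc, LinearMap.sub_apply, LinearMap.id_apply, LinearMap.smul_apply, map_smul,
      rot_genTrace]
    rw [zero_smul, zero_add]
    have h2 : (-1 : k) ^ (2 * n + 1) = -1 := by simp [pow_add, pow_mul]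
    have h3 : (-1 : k) ^ (2 * n + 1 + 1) = 1 := by simp [pow_add, pow_mul]
    rw [h2, h3, neg_one_smul, sub_neg_eq_add, ← two_smul k, smul_smul, one_smul]
    rw [inv_mul_cancel₀ two_ne_zero, one_smul]

section Cocycle

variable {R : Type*} [Ring R] [Algebra k R] {n : ℕ}
  (Φ : MultilinearMap k (fun _ : Fin (2 * n + 1) => R) k)

theorem cocycle_update_zero
    (H : ∀ M : Fin (2 * n + 2) → R,
      (∑ i : Fin (2 * n + 1), (-1 : k) ^ (i : ℕ) • Φ (faceFun i M)) +
        (-1 : k) ^ (2 * n + 1) • Φ (faceFun 0 fun j => M ((finRotate (2 * n + 2)).symm j)) = 0)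
    {g X : R} (hg : g * g = g) (hX : (g * X = X ∧ X * g = 0) ∨ (X * g = X ∧ g * X = 0)) :
    Φ (Function.update (fun _ => g) 0 X) = 0 := by
  have h := H (Function.update (fun _ => g) 0 X)
  have e0 : faceFun (0 : Fin (2 * n + 1)) (Function.update (fun _ => g) 0 X) =
      Function.update (fun _ => g) 0 (X * g) := by
    funext j
    refine Fin.cases ?_ (fun j => ?_) j <;> simp [faceFun]
  have e1 : ∀ i : Fin (2 * n + 1), i ≠ 0 →
      faceFun i (Function.update (fun _ => g) 0 X) = Function.update (fun _ => g) 0 X := by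
    intro i hi
    rw [faceFun_update, faceFun_const _ hg]
    have h1 : (0 : Fin (2 * n + 2)) ≠ i.castSucc := by
      simpa [eq_comm] using hi
    simp [h1, (Fin.succ_ne_zero i).symm]
  have e2 : (fun j => (Function.update (fun _ => g) 0 X : Fin (2 * n + 2) → R)
      ((finRotate (2 * n + 2)).symm j)) = Function.update (fun _ => g) 1 X := by
    funext j
    obtain ⟨j, rfl⟩ := (finRotate _).surjective j
    by_cases hj : j = 0
    · simp [hj]
    · simp [hj]
  have e3 : faceFun (0 : Fin (2 * n + 1)) (Function.update (fun _ => g) 1 X) =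
      Function.update (fun _ => g) 0 (g * X) := by
    rw [faceFun_update, faceFun_const _ hg]
    simp
  rw [e2, e3, Fin.sum_univ_succ, e0] at h
  have h4 : ∑ i : Fin (2 * n), (-1 : k) ^ ((i.succ : Fin (2 * n + 1)) : ℕ) = 0 := by
    have := alternating_sum (k := k) n
    rw [Fin.sum_univ_succ] at this
    simpa using this
  have h5 : ∑ i : Fin (2 * n), (-1 : k) ^ ((i.succ : Fin (2 * n + 1)) : ℕ) •
      Φ (faceFun i.succ (Function.update (fun _ => g) 0 X)) = 0 := by
    simp only [e1 _ (Fin.succ_ne_zero _), ← Finset.sum_smul, h4, zero_smul]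
  rw [h5] at h
  have z : Φ (Function.update (fun _ => g) 0 0) = 0 := Φ.map_update_zero _ _
  rcases hX with ⟨h6, h7⟩ | ⟨h6, h7⟩
  · simpa [h6, h7, z, pow_add, pow_mul] using h
  · simpa [h6, h7, z, pow_add, pow_mul] using h

theorem cocycle_update
    (H1 : ∀ M, Φ (fun j => M ((finRotate (2 * n + 1)).symm j)) = Φ M)
    {g X : R} (h : Φ (Function.update (fun _ => g) 0 X) = 0) (j : Fin (2 * n + 1)) :
    Φ (Function.update (fun _ => g) j X) = 0 := by
  induction j using Fin.induction with
  | zero => exact h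
  | succ i ih =>
    rw [← ih, ← H1 (Function.update (fun _ => g) i.castSucc X)]
    congr 1
    funext j
    obtain ⟨j, rfl⟩ := (finRotate _).surjective j
    have : (finRotate (2 * n + 1) j = i.succ) ↔ j = i.castSucc := by
      rw [← (finRotate (2 * n + 1)).injective.eq_iff (a := j)]
      simp
    by_cases hj : j = i.castSucc
    · rw [Equiv.symm_apply_apply, this.2 hj, hj, Function.update_self, Function.update_self]
    · have h2 : finRotate (2 * n + 1) j ≠ i.succ := fun h => hj (this.1 h)
      rw [Function.update_of_ne h2, Equiv.symm_apply_apply, Function.update_of_ne hj]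

open Polynomial in
theorem exists_poly (a X : R) :
    ∃ p : k[X], (∀ s : k, p.eval s = Φ (fun _ => a + s • X)) ∧
      ((∀ j, Φ (Function.update (fun _ => a) j X) = 0) → p.coeff 1 = 0) := by
  refine ⟨∑ S : Finset (Fin (2 * n + 1)),
    C (Φ (S.piecewise (fun _ => a) fun _ => X)) * Polynomial.X ^ Sᶜ.card, fun s => ?_, fun h => ?_⟩
  · have := Φ.map_add_univ (fun _ => a) (fun _ => s • X)
    change Φ (fun _ => a + s • X) = _ at this
    rw [this, eval_finsetSum]
    refine Finset.sum_congr rfl fun S _ => ?_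
    have h2 := Φ.map_piecewise_smul (fun _ => s) (S.piecewise (fun _ => a) fun _ => X) Sᶜ
    simp only [Finset.prod_const] at h2
    rw [eval_mul, eval_C, eval_pow, eval_X, mul_comm, ← smul_eq_mul, ← h2]
    congr 1
    funext j
    by_cases hj : j ∈ S <;> simp [Finset.piecewise, hj]
  · rw [finsetSum_coeff]
    refine Finset.sum_eq_zero fun S _ => ?_
    rw [coeff_C_mul_X_pow]
    split_ifs with hS
    · obtain ⟨j, hj⟩ := Finset.card_eq_one.1 hS.symm
      rw [← h j]
      congr 1
      funext i
      have : i ∈ S ↔ i ≠ j := by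
        rw [← not_iff_not, ← Finset.mem_compl, hj]; simp
      by_cases hi : i = j
      · subst hi; simp [this]
      · simp [this, hi]
    · rfl

open Polynomial in
theorem cocycle_line [CharZero k]
    (H1 : ∀ M, Φ (fun j => M ((finRotate (2 * n + 1)).symm j)) = Φ M)
    (H : ∀ M : Fin (2 * n + 2) → R,
      (∑ i : Fin (2 * n + 1), (-1 : k) ^ (i : ℕ) • Φ (faceFun i M)) +
        (-1 : k) ^ (2 * n + 1) • Φ (faceFun 0 fun j => M ((finRotate (2 * n + 2)).symm j)) = 0)
    {g X : R} (hg : g * g = g) (hX : (g * X = X ∧ X * g = 0) ∨ (X * g = X ∧ g * X = 0)) :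
    Φ (fun _ => g + X) = Φ (fun _ => g) := by
  obtain ⟨p, hp, -⟩ := exists_poly Φ g X
  have hXX : X * X = 0 := by
    rcases hX with ⟨h1, h2⟩ | ⟨h1, h2⟩
    · nth_rewrite 2 [← h1]; rw [← mul_assoc, h2, zero_mul]
    · nth_rewrite 1 [← h1]; rw [mul_assoc, h2, mul_zero]
  have hd : derivative p = 0 := by
    refine Polynomial.funext fun s => ?_
    obtain ⟨q, hq, hq'⟩ := exists_poly Φ (g + s • X) X
    have hX' : ((g + s • X) * X = X ∧ X * (g + s • X) = 0) ∨
        (X * (g + s • X) = X ∧ (g + s • X) * X = 0) := by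
      simpa [add_mul, mul_add, hXX] using hX
    have hg' : (g + s • X) * (g + s • X) = g + s • X := by
      rcases hX with ⟨h1, h2⟩ | ⟨h1, h2⟩ <;> simp [add_mul, mul_add, hXX, h1, h2, hg]
    have e : taylor s p = q := by
      refine Polynomial.funext fun h => ?_
      rw [taylor_eval, hp, hq]
      congr 1
      funext _
      rw [add_smul]; abel
    rw [eval_zero, ← taylor_coeff_one, e]
    exact hq' (cocycle_update Φ H1 (cocycle_update_zero Φ H hg' hX'))
  have h2 := eq_C_of_derivative_eq_zero hd
  have h3 := hp 1
  have h4 := hp 0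
  rw [h2, eval_C] at h3 h4
  simp only [one_smul, zero_smul, add_zero] at h3 h4
  rw [← h3, ← h4]

theorem cocycle_equiv [CharZero k]
    (H1 : ∀ M, Φ (fun j => M ((finRotate (2 * n + 1)).symm j)) = Φ M)
    (H : ∀ M : Fin (2 * n + 2) → R,
      (∑ i : Fin (2 * n + 1), (-1 : k) ^ (i : ℕ) • Φ (faceFun i M)) +
        (-1 : k) ^ (2 * n + 1) • Φ (faceFun 0 fun j => M ((finRotate (2 * n + 2)).symm j)) = 0)
    {e f u v : R} (huv : u * v = e) (hvu : v * u = f) (heu : e * u = u) (hfv : f * v = v)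
    (hef : e * f = 0) (hfe : f * e = 0) :
    Φ (fun _ => e) = Φ (fun _ => f) := by
  have huf : u * f = u := by rw [← hvu, ← mul_assoc, huv, heu]
  have hve : v * e = v := by rw [← huv, ← mul_assoc, hvu, hfv]
  have hee : e * e = e := by nth_rewrite 2 [← huv]; rw [← mul_assoc, heu, huv]
  have hff : f * f = f := by nth_rewrite 2 [← hvu]; rw [← mul_assoc, hfv, hvu]
  have hue : u * e = 0 := by rw [← huf, mul_assoc, hfe, mul_zero]
  have hvf : v * f = 0 := by rw [← hve, mul_assoc, hef, mul_zero]
  have hfu : f * u = 0 := by rw [← heu, ← mul_assoc, hfe, zero_mul]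
  have hev : e * v = 0 := by rw [← hfv, ← mul_assoc, hef, zero_mul]
  have huu : u * u = 0 := by nth_rewrite 2 [← heu]; rw [← mul_assoc, hue, zero_mul]
  have hvv : v * v = 0 := by nth_rewrite 2 [← hfv]; rw [← mul_assoc, hvf, zero_mul]
  have s1 := cocycle_line Φ H1 H (g := e) (X := u) hee (Or.inl ⟨heu, hue⟩)
  have s2 := cocycle_line Φ H1 H (g := f) (X := v) hff (Or.inl ⟨hfv, hvf⟩)
  have s3 := cocycle_line Φ H1 H (g := e + u) (X := v + f - e - u)
    (by simp [add_mul, mul_add, hee, heu, hue, huu])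
    (Or.inr ⟨by
          simp [add_mul, mul_add, sub_mul, hee, heu, hue, huu, hve, hvu, hfe, hfu]
          abel,
      by simp [add_mul, mul_sub, mul_add, hee, heu, hue, huu, hev, huv, hef, huf]⟩)
  rw [← s1, ← s3, ← s2]
  congr 1
  funext _
  abel

end Cocycle

variable {κ : Type*} [Fintype κ]

theorem genTrace_fromBlocks {m : ℕ} (E : Matrix ι ι A) (F : Matrix κ κ A) :
    genTrace k m (fun _ => Matrix.fromBlocks E 0 0 F) =
      genTrace k m (fun _ => E) + genTrace k m (fun _ => F) := by
  classical
  rw [genTrace_apply, genTrace_apply, genTrace_apply]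
  refine Eq.symm (Eq.trans (Fintype.sum_sum_type
    (Sum.elim
      (fun p : Fin (m + 1) → ι => PiTensorProduct.tprod k fun j => E (p j) (p (j + 1)))
      (fun p : Fin (m + 1) → κ => PiTensorProduct.tprod k fun j => F (p j) (p (j + 1))))).symm ?_)
  refine Fintype.sum_of_injective
    (Sum.elim (fun (p : Fin (m + 1) → ι) j => Sum.inl (p j))
      (fun (p : Fin (m + 1) → κ) j => Sum.inr (p j))) ?_ _ _ ?_ ?_
  · rintro (p | p) (q | q) h
    · exact congrArg _ (funext fun j => Sum.inl_injective (congrFun h j))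
    · exact absurd (congrFun h 0) (by simp)
    · exact absurd (congrFun h 0) (by simp)
    · exact congrArg _ (funext fun j => Sum.inr_injective (congrFun h j))
  · intro p hp
    by_cases h : ∀ j, (p j).isLeft = (p (j + 1)).isLeft
    · have h0 : ∀ j, (p j).isLeft = (p 0).isLeft := by
        intro j
        induction j using Fin.induction with
        | zero => rfl
        | succ i ih => rw [← ih, h i.castSucc, Fin.coeSucc_eq_succ]
      refine absurd ?_ hp
      cases hc : (p 0).isLeft with
      | true =>
        choose q hq using fun j => Sum.isLeft_iff.1 ((h0 j).trans hc)
        exact ⟨Sum.inl q, funext fun j => (hq j).symm⟩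
      | false =>
        choose q hq using fun j => Sum.isRight_iff.1 (Sum.isLeft_eq_false.1 ((h0 j).trans hc))
        exact ⟨Sum.inr q, funext fun j => (hq j).symm⟩
    · push Not at h
      obtain ⟨j, hj⟩ := h
      refine MultilinearMap.map_coord_zero _ j ?_
      revert hj
      rcases p j with a | a <;> rcases p (j + 1) with b | b <;> simp
  · rintro (p | p) <;> simp

theorem genTrace_sub_mem_boundaries [CharZero k] {E : Matrix ι ι A} {F : Matrix κ κ A}
    {u : Matrix ι κ A} {v : Matrix κ ι A} (huv : u * v = E) (hvu : v * u = F) (heu : E * u = u)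
    (hfv : F * v = v) (n : ℕ) :
    genTrace k (2 * n) (fun _ => E) - genTrace k (2 * n) (fun _ => F) ∈
      boundaries k A (2 * n) := by
  classical
  rw [← Submodule.Quotient.mk_eq_zero, ← Submodule.mkQ_apply,
    ← Module.forall_dual_apply_eq_zero_iff k]
  intro l
  have key := cocycle_equiv (R := Matrix (ι ⊕ κ) (ι ⊕ κ) A) (n := n)
    ((l ∘ₗ (boundaries k A (2 * n)).mkQ).compMultilinearMap (genTrace k (2 * n)))
    (fun M => by
      simp only [LinearMap.compMultilinearMap_apply, LinearMap.comp_apply]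
      congr 1
      rw [Submodule.mkQ_apply, Submodule.mkQ_apply, eq_comm, Submodule.Quotient.eq]
      refine Submodule.mem_sup_left ⟨genTrace k (2 * n) M, ?_⟩
      simp [cyc, rot_genTrace, pow_mul])
    (fun M => by
      have h0 : (l ∘ₗ (boundaries k A (2 * n)).mkQ)
          (hoch k A (2 * n) (genTrace k (2 * n + 1) M)) = 0 := by
        rw [LinearMap.comp_apply, Submodule.mkQ_apply,
          (Submodule.Quotient.mk_eq_zero (boundaries k A (2 * n))).2
            (Submodule.mem_sup_right ⟨_, rfl⟩), map_zero]
      rw [hoch_genTrace] at h0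
      simpa only [map_add, map_sum, map_smul, LinearMap.compMultilinearMap_apply] using h0)
    (e := Matrix.fromBlocks E 0 0 0) (f := Matrix.fromBlocks 0 0 0 F)
    (u := Matrix.fromBlocks 0 u 0 0) (v := Matrix.fromBlocks 0 0 v 0)
    (by simp [Matrix.fromBlocks_multiply, huv]) (by simp [Matrix.fromBlocks_multiply, hvu])
    (by simp [Matrix.fromBlocks_multiply, heu]) (by simp [Matrix.fromBlocks_multiply, hfv])
    (by simp [Matrix.fromBlocks_multiply]) (by simp [Matrix.fromBlocks_multiply])
  simp only [LinearMap.compMultilinearMap_apply, genTrace_fromBlocks] at key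
  have z1 : genTrace k (2 * n) (fun _ => (0 : Matrix ι ι A)) = 0 :=
    MultilinearMap.map_coord_zero _ 0 rfl
  have z2 : genTrace k (2 * n) (fun _ => (0 : Matrix κ κ A)) = 0 :=
    MultilinearMap.map_coord_zero _ 0 rfl
  rw [z1, z2, add_zero, zero_add] at key
  rw [map_sub, map_sub, sub_eq_zero]
  exact key

end Cyclic

section KTheory

/-- A finitely generated projective left module, in the universe `w`. -/
structure FGProj (B : Type u) [Ring B] : Type (max u (w + 1)) where
  carrier : Type w
  [addCommGroup : AddCommGroup carrier]
  [module : Module B carrier]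
  [finite : Module.Finite B carrier]
  [projective : Module.Projective B carrier]

attribute [instance] FGProj.addCommGroup FGProj.module FGProj.finite FGProj.projective

variable (B : Type u) [Ring B]

/-- Isomorphism of finitely generated projective modules. -/
instance FGProj.setoid : Setoid (FGProj.{u, w} B) where
  r M N := Nonempty (M.carrier ≃ₗ[B] N.carrier)
  iseqv := ⟨fun _ => ⟨.refl _ _⟩, fun ⟨f⟩ => ⟨f.symm⟩, fun ⟨f⟩ ⟨g⟩ => ⟨f.trans g⟩⟩

/-- Isomorphism classes of finitely generated projective left `B`-modules. -/
def ProjClass : Type (max u (w + 1)) := Quotient (FGProj.setoid.{u, w} B)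

/-- The direct sum of isomorphism classes. -/
instance : Add (ProjClass.{u, w} B) where
  add := Quotient.map₂ (fun M N => ⟨M.carrier × N.carrier⟩)
    fun _ _ ⟨f⟩ _ _ ⟨g⟩ => ⟨f.prodCongr g⟩

/-- The class of the zero module. -/
instance : Zero (ProjClass.{u, w} B) where
  zero := Quotient.mk _ ⟨PUnit⟩

instance : AddCommMonoid (ProjClass.{u, w} B) where
  add_assoc := by
    rintro ⟨M⟩ ⟨N⟩ ⟨L⟩
    exact Quotient.sound ⟨LinearEquiv.prodAssoc B _ _ _⟩
  zero_add := by
    rintro ⟨M⟩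
    exact Quotient.sound ⟨LinearEquiv.uniqueProd⟩
  add_zero := by
    rintro ⟨M⟩
    exact Quotient.sound ⟨LinearEquiv.prodUnique⟩
  add_comm := by
    rintro ⟨M⟩ ⟨N⟩
    exact Quotient.sound ⟨LinearEquiv.prodComm B _ _⟩
  nsmul := nsmulRec

/-- `K₀(B)`: the Grothendieck group of the finitely generated projective left `B`-modules. -/
abbrev K0 : Type (max u (w + 1)) := Algebra.GrothendieckAddGroup (ProjClass.{u, w} B)

/-- The class `[M]` in `K₀(B)`. -/
noncomputable def K0.of (M : Type w) [AddCommGroup M] [Module B M] [Module.Finite B M]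
    [Module.Projective B M] : K0.{u, w} B :=
  Algebra.GrothendieckAddGroup.of (Quotient.mk (FGProj.setoid.{u, w} B) ⟨M⟩ : ProjClass.{u, w} B)

end KTheory

section Chern

variable {B : Type u} [Ring B]

/-- A finite dual basis of `M`: elements `xᵢ` and functionals `fᵢ` with `m = ∑ fᵢ(m) xᵢ`. -/
structure DualBasis (B : Type u) [Ring B] (ι : Type v) [Fintype ι] (M : Type w) [AddCommGroup M]
    [Module B M] where
  x : ι → M
  f : ι → M →ₗ[B] B
  sum_eq : ∀ m, ∑ i, f i m • x i = m

namespace DualBasis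

variable {ι : Type*} [Fintype ι] {M : Type*} [AddCommGroup M] [Module B M]

/-- The matrix with entries `fⱼ(xᵢ)`, an idempotent `E` with `B^ι E ≅ M` (row vectors). -/
def matrix (D : DualBasis B ι M) : Matrix ι ι B := fun i j => D.f j (D.x i)

theorem mul_aux {α γ : Type*} (D : DualBasis B ι M) (x : α → M) (f : γ → M →ₗ[B] B) :
    (Matrix.of fun a j => D.f j (x a) : Matrix α ι B) * (Matrix.of fun i c => f c (D.x i)) =
      (Matrix.of fun a c => f c (x a) : Matrix α γ B) := by
  ext a c
  simp only [Matrix.mul_apply, Matrix.of_apply]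
  conv_rhs => rw [← D.sum_eq (x a)]
  simp

theorem isIdempotentElem (D : DualBasis B ι M) : IsIdempotentElem D.matrix :=
  D.mul_aux D.x D.f

theorem exists_fin (B : Type u) [Ring B] (M : Type*) [AddCommGroup M] [Module B M]
    [Module.Finite B M] [Module.Projective B M] : ∃ N : ℕ, Nonempty (DualBasis B (Fin N) M) := by
  obtain ⟨N, p, s, hp, hs, h⟩ := Module.Finite.exists_comp_eq_id_of_projective B M
  refine ⟨N, ⟨⟨fun i => p (fun j => if i = j then 1 else 0), fun i => LinearMap.proj i ∘ₗ s,
    fun m => ?_⟩⟩⟩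
  have := p.pi_apply_eq_sum_univ (s m)
  rw [← LinearMap.comp_apply, h] at this
  exact this.symm

variable {κ : Type*} [Fintype κ] {N : Type*} [AddCommGroup N] [Module B N]

/-- The direct sum of two dual bases. -/
def prod (D : DualBasis B ι M) (D' : DualBasis B κ N) : DualBasis B (ι ⊕ κ) (M × N) where
  x := Sum.elim (fun i => (D.x i, 0)) fun j => (0, D'.x j)
  f := Sum.elim (fun i => D.f i ∘ₗ LinearMap.fst B M N) fun j => D'.f j ∘ₗ LinearMap.snd B M N
  sum_eq := by
    rintro ⟨m, n⟩
    simp [Prod.ext_iff, Prod.fst_sum, Prod.snd_sum, D.sum_eq, D'.sum_eq]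

theorem matrix_prod (D : DualBasis B ι M) (D' : DualBasis B κ N) :
    (D.prod D').matrix = Matrix.fromBlocks D.matrix 0 0 D'.matrix := by
  ext (i | i) (j | j) <;> simp [matrix, prod]

/-- Transport of a dual basis along an isomorphism. -/
def map (D : DualBasis B ι M) (φ : M ≃ₗ[B] N) : DualBasis B ι N where
  x i := φ (D.x i)
  f i := D.f i ∘ₗ φ.symm.toLinearMap
  sum_eq n := by
    apply φ.symm.injective
    simpa using D.sum_eq (φ.symm n)

theorem matrix_map (D : DualBasis B ι M) (φ : M ≃ₗ[B] N) : (D.map φ).matrix = D.matrix := by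
  ext; simp [matrix, map]

variable (k : Type*) [Field k] [CharZero k] [Algebra k B]

/-- The class `(-1)ⁿ [∑ E(p₀,p₁) ⊗ E(p₁,p₂) ⊗ … ⊗ E(p₂ₙ,p₀)]` in `HC₂ₙ(B)`, where `E` is the
idempotent matrix `(fⱼ(xᵢ))`. -/
noncomputable def chernClass (D : DualBasis B ι M) (n : ℕ) : HC k B (2 * n) :=
  (-1 : k) ^ n • HC.mk k B _ (genTrace_mem_cycles D.isIdempotentElem n)

theorem chernClass_eq (D : DualBasis B ι M) (D' : DualBasis B κ M) (n : ℕ) :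
    D.chernClass k n = D'.chernClass k n := by
  unfold chernClass
  congr 1
  rw [HC.mk_eq_mk]
  exact genTrace_sub_mem_boundaries (D'.mul_aux D.x D.f) (D.mul_aux D'.x D'.f)
    (D.mul_aux D.x D'.f) (D'.mul_aux D'.x D.f) n

theorem chernClass_map (D : DualBasis B ι M) (φ : M ≃ₗ[B] N) (n : ℕ) :
    (D.map φ).chernClass k n = D.chernClass k n := by
  unfold chernClass
  congr 1
  rw [HC.mk_eq_mk, matrix_map, sub_self]
  exact zero_mem _

theorem chernClass_prod (D : DualBasis B ι M) (D' : DualBasis B κ N) (n : ℕ) :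
    (D.prod D').chernClass k n = D.chernClass k n + D'.chernClass k n := by
  unfold chernClass
  rw [← smul_add]
  congr 1
  rw [← HC.mk_add, HC.mk_eq_mk, matrix_prod, genTrace_fromBlocks, sub_self]
  exact zero_mem _

end DualBasis

variable (k : Type*) [Field k] [CharZero k] (B) [Algebra k B]

/-- The Chern character `ch₂ₙ(M)` of a finitely generated projective module, computed from any
finite dual basis. -/
noncomputable def chernObj (n : ℕ) (M : Type*) [AddCommGroup M] [Module B M] [Module.Finite B M]
    [Module.Projective B M] : HC k B (2 * n) :=
  (DualBasis.exists_fin B M).choose_spec.some.chernClass k n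

theorem chernObj_eq (n : ℕ) {M : Type*} [AddCommGroup M] [Module B M] [Module.Finite B M]
    [Module.Projective B M] {ι : Type*} [Fintype ι] (D : DualBasis B ι M) :
    chernObj B k n M = D.chernClass k n :=
  DualBasis.chernClass_eq k _ _ n

/-- The Chern character `ch₂ₙ : K₀(B) → HC₂ₙ(B)`. -/
noncomputable def chern (n : ℕ) : K0.{u, w} B →+ HC k B (2 * n) :=
  Algebra.GrothendieckAddGroup.lift
    { toFun := Quotient.lift (fun M : FGProj.{u, w} B => chernObj B k n M.carrier) (by
        rintro M N ⟨φ⟩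
        obtain ⟨_, ⟨D⟩⟩ := DualBasis.exists_fin B M.carrier
        rw [chernObj_eq B k n D, chernObj_eq B k n (D.map φ), DualBasis.chernClass_map])
      map_zero' := by
        let D : DualBasis B (Fin 0) PUnit.{w + 1} := ⟨Fin.elim0, Fin.elim0, fun _ => rfl⟩
        change chernObj B k n PUnit.{w + 1} = 0
        rw [chernObj_eq B k n D, DualBasis.chernClass]
        have z : genTrace k (2 * n) (fun _ => D.matrix) = 0 :=
          MultilinearMap.map_coord_zero _ 0 (Subsingleton.elim _ _)
        have : HC.mk k B _ (genTrace_mem_cycles D.isIdempotentElem n) =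
            HC.mk k B 0 (zero_mem (cycles k B (2 * n))) := by
          rw [HC.mk_eq_mk, z, sub_self]
          exact zero_mem _
        rw [this]
        exact smul_zero _
      map_add' := by
        rintro ⟨M⟩ ⟨N⟩
        obtain ⟨_, ⟨D⟩⟩ := DualBasis.exists_fin B M.carrier
        obtain ⟨_, ⟨D'⟩⟩ := DualBasis.exists_fin B N.carrier
        change chernObj B k n (M.carrier × N.carrier) =
          chernObj B k n M.carrier + chernObj B k n N.carrier
        rw [chernObj_eq B k n D, chernObj_eq B k n D', chernObj_eq B k n (D.prod D'),
          DualBasis.chernClass_prod] }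

theorem chern_of (n : ℕ) (M : Type w) [AddCommGroup M] [Module B M] [Module.Finite B M]
    [Module.Projective B M] : chern B k n (K0.of B M) = chernObj B k n M := by
  rw [chern, K0.of]
  exact DFunLike.congr_fun (Algebra.GrothendieckAddGroup.lift.symm_apply_apply _) _

/-- For an idempotent matrix `E`, the row space `B^ι E` has Chern character
`(-1)ⁿ [∑ E(p₀,p₁) ⊗ … ⊗ E(p₂ₙ,p₀)]`. -/
theorem chernObj_rowSpace (n : ℕ) {ι : Type*} [Fintype ι] {E : Matrix ι ι B}
    (hE : IsIdempotentElem E) [Module.Finite B (LinearMap.range E.vecMulLinear)]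
    [Module.Projective B (LinearMap.range E.vecMulLinear)] :
    chernObj B k n (LinearMap.range E.vecMulLinear) =
      (-1 : k) ^ n • HC.mk k B _ (genTrace_mem_cycles hE n) := by
  classical
  let D : DualBasis B ι (LinearMap.range E.vecMulLinear) :=
    { x := fun i => ⟨E i, Pi.single i 1, by simp [Matrix.row]⟩
      f := fun i => LinearMap.proj i ∘ₗ Submodule.subtype _
      sum_eq := by
        rintro ⟨_, w, rfl⟩
        ext j
        have : (w ᵥ* E) ᵥ* E = w ᵥ* E := by rw [Matrix.vecMul_vecMul, hE.eq]
        have h2 := congrFun this j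
        simpa [Matrix.vecMul, dotProduct] using h2 }
  rw [chernObj_eq B k n D]
  rfl

end Chern

section Principal

variable {k : Type uk} [Field k] {C : Type uC} [AddCommGroup C] [Module k C] [Coalgebra k C]

/-- `δ` is a (coassociative and counital) right coaction of the coalgebra `C` on `V`. -/
structure IsRightCoaction {V : Type*} [AddCommGroup V] [Module k V] (δ : V →ₗ[k] V ⊗[k] C) :
    Prop where
  coassoc : (TensorProduct.assoc k V C C).toLinearMap ∘ₗ δ.rTensor C ∘ₗ δ =
    (Coalgebra.comul (R := k) (A := C)).lTensor V ∘ₗ δ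
  counit : (TensorProduct.rid k V).toLinearMap ∘ₗ
    (Coalgebra.counit (R := k) (A := C)).lTensor V ∘ₗ δ = LinearMap.id

/-- `f` is right `C`-colinear. -/
def IsColinear {V W : Type*} [AddCommGroup V] [Module k V] [AddCommGroup W] [Module k W]
    (δV : V →ₗ[k] V ⊗[k] C) (δW : W →ₗ[k] W ⊗[k] C) (f : V →ₗ[k] W) : Prop :=
  δW ∘ₗ f = f.rTensor C ∘ₗ δV

/-- A colinear map is compatible with both axioms of a coaction. -/
theorem IsRightCoaction.of_colinear {V W : Type*} [AddCommGroup V] [Module k V] [AddCommGroup W]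
    [Module k W] {δV : V →ₗ[k] V ⊗[k] C} {δW : W →ₗ[k] W ⊗[k] C} (h : IsRightCoaction δV)
    {j : V →ₗ[k] W} (hj : IsColinear δV δW j) :
    ((TensorProduct.assoc k W C C).toLinearMap ∘ₗ δW.rTensor C ∘ₗ δW) ∘ₗ j =
      ((Coalgebra.comul (R := k) (A := C)).lTensor W ∘ₗ δW) ∘ₗ j ∧
    ((TensorProduct.rid k W).toLinearMap ∘ₗ
      (Coalgebra.counit (R := k) (A := C)).lTensor W ∘ₗ δW) ∘ₗ j = LinearMap.id ∘ₗ j := by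
  have hj' : ∀ v, δW (j v) = j.rTensor C (δV v) := fun v => LinearMap.congr_fun hj v
  constructor
  · ext v
    have h1 := LinearMap.congr_fun h.coassoc v
    simp only [LinearMap.comp_apply, LinearEquiv.coe_coe] at h1 ⊢
    have e1 : ∀ x, TensorProduct.assoc k W C C (δW.rTensor C (j.rTensor C x)) =
        j.rTensor (C ⊗[k] C) (TensorProduct.assoc k V C C (δV.rTensor C x)) := by
      intro x
      induction x with
      | zero => simp
      | tmul y c =>
        simp only [LinearMap.rTensor_tmul, hj']
        generalize δV y = z
        induction z with
        | zero => simp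
        | tmul y c => simp
        | add x y hx hy => simp only [map_add, TensorProduct.add_tmul, hx, hy]
      | add x y hx hy => simp only [map_add, hx, hy]
    rw [hj', e1, h1]
    generalize δV v = x
    induction x with
    | zero => simp
    | tmul y c => simp
    | add x y hx hy => simp only [map_add, hx, hy]
  · ext v
    have h1 := LinearMap.congr_fun h.counit v
    simp only [LinearMap.comp_apply, LinearEquiv.coe_coe, LinearMap.id_apply] at h1 ⊢
    rw [hj']
    conv_rhs => rw [← h1]
    generalize δV v = x
    induction x with
    | zero => simp
    | tmul y c => simp
    | add x y hx hy => simp only [map_add, hx, hy]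

section Sum

variable {U V W X : Type*} [AddCommGroup U] [Module k U] [AddCommGroup V] [Module k V]
  [AddCommGroup W] [Module k W] [AddCommGroup X] [Module k X] {δU : U →ₗ[k] U ⊗[k] C}
  {δV : V →ₗ[k] V ⊗[k] C} {δW : W →ₗ[k] W ⊗[k] C} {δX : X →ₗ[k] X ⊗[k] C}

theorem IsColinear.comp {g : V →ₗ[k] W} {f : U →ₗ[k] V} (hg : IsColinear δV δW g)
    (hf : IsColinear δU δV f) : IsColinear δU δW (g ∘ₗ f) := by
  unfold IsColinear at *
  rw [← LinearMap.comp_assoc, hg, LinearMap.comp_assoc, hf, LinearMap.rTensor_comp,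
    LinearMap.comp_assoc]

theorem IsColinear.id (δV : V →ₗ[k] V ⊗[k] C) : IsColinear δV δV LinearMap.id := by
  simp [IsColinear]

theorem IsColinear.symm {f : V ≃ₗ[k] W} (hf : IsColinear δV δW f.toLinearMap) :
    IsColinear δW δV f.symm.toLinearMap := by
  unfold IsColinear at *
  have h1 : f.symm.toLinearMap ∘ₗ f.toLinearMap = LinearMap.id := by ext; simp
  have h2 : f.toLinearMap ∘ₗ f.symm.toLinearMap = LinearMap.id := by ext; simp
  calc δV ∘ₗ f.symm.toLinearMap
      = (f.symm.toLinearMap ∘ₗ f.toLinearMap).rTensor C ∘ₗ δV ∘ₗ f.symm.toLinearMap := by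
        rw [h1, LinearMap.rTensor_id, LinearMap.id_comp]
    _ = f.symm.toLinearMap.rTensor C ∘ₗ (f.toLinearMap.rTensor C ∘ₗ δV) ∘ₗ
          f.symm.toLinearMap := by
        rw [LinearMap.rTensor_comp, LinearMap.comp_assoc, LinearMap.comp_assoc]
    _ = _ := by rw [← hf, LinearMap.comp_assoc, h2, LinearMap.comp_id]

/-- The direct sum of two coactions. -/
noncomputable def prodCoact (δV : V →ₗ[k] V ⊗[k] C) (δW : W →ₗ[k] W ⊗[k] C) :
    V × W →ₗ[k] (V × W) ⊗[k] C :=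
  ((LinearMap.inl k V W).rTensor C ∘ₗ δV).coprod ((LinearMap.inr k V W).rTensor C ∘ₗ δW)

theorem inl_colinear (δV : V →ₗ[k] V ⊗[k] C) (δW : W →ₗ[k] W ⊗[k] C) :
    IsColinear δV (prodCoact δV δW) (LinearMap.inl k V W) :=
  LinearMap.coprod_inl _ _

theorem inr_colinear (δV : V →ₗ[k] V ⊗[k] C) (δW : W →ₗ[k] W ⊗[k] C) :
    IsColinear δW (prodCoact δV δW) (LinearMap.inr k V W) :=
  LinearMap.coprod_inr _ _

theorem prod_colinear {f : V × W →ₗ[k] X} (h1 : IsColinear δV δX (f ∘ₗ LinearMap.inl k V W))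
    (h2 : IsColinear δW δX (f ∘ₗ LinearMap.inr k V W)) :
    IsColinear (prodCoact δV δW) δX f := by
  refine LinearMap.prod_ext ?_ ?_
  · rw [LinearMap.comp_assoc, h1, LinearMap.rTensor_comp, LinearMap.comp_assoc,
      LinearMap.comp_assoc, ← inl_colinear δV δW]
  · rw [LinearMap.comp_assoc, h2, LinearMap.rTensor_comp, LinearMap.comp_assoc,
      LinearMap.comp_assoc, ← inr_colinear δV δW]

theorem IsRightCoaction.prod (hV : IsRightCoaction δV) (hW : IsRightCoaction δW) :
    IsRightCoaction (prodCoact δV δW) :=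
  have h1 := hV.of_colinear (inl_colinear δV δW)
  have h2 := hW.of_colinear (inr_colinear δV δW)
  ⟨LinearMap.prod_ext h1.1 h2.1, LinearMap.prod_ext h1.2 h2.2⟩

theorem prodAssoc_colinear (δU : U →ₗ[k] U ⊗[k] C) (δV : V →ₗ[k] V ⊗[k] C)
    (δW : W →ₗ[k] W ⊗[k] C) : IsColinear (prodCoact (prodCoact δU δV) δW)
      (prodCoact δU (prodCoact δV δW)) (LinearEquiv.prodAssoc k U V W).toLinearMap := by
  refine prod_colinear (prod_colinear ?_ ?_) ?_
  · convert inl_colinear δU (prodCoact δV δW) using 1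
    ext <;> simp
  · convert (inr_colinear δU (prodCoact δV δW)).comp (inl_colinear δV δW) using 1
    ext <;> simp
  · convert (inr_colinear δU (prodCoact δV δW)).comp (inr_colinear δV δW) using 1
    ext <;> simp

theorem prodCongr_colinear {f : U ≃ₗ[k] V} {g : W ≃ₗ[k] X} (hf : IsColinear δU δV f.toLinearMap)
    (hg : IsColinear δW δX g.toLinearMap) :
    IsColinear (prodCoact δU δW) (prodCoact δV δX) (f.prodCongr g).toLinearMap := by
  refine prod_colinear ?_ ?_
  · convert (inl_colinear δV δX).comp hf using 1
    ext <;> simp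
  · convert (inr_colinear δV δX).comp hg using 1
    ext <;> simp

theorem colinear_of_subsingleton [Subsingleton V] (f : V →ₗ[k] W) : IsColinear δV δW f :=
  LinearMap.ext fun x => by rw [Subsingleton.elim x 0, map_zero, map_zero]

end Sum

variable (k C) in
/-- A finite-dimensional corepresentation of `C`. -/
structure FinCorep : Type (max uk uC (w + 1)) where
  carrier : Type w
  [addCommGroup : AddCommGroup carrier]
  [module : Module k carrier]
  [finite : Module.Finite k carrier]
  coact : carrier →ₗ[k] carrier ⊗[k] C
  isRightCoaction : IsRightCoaction coact

attribute [instance] FinCorep.addCommGroup FinCorep.module FinCorep.finite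

/-- Isomorphism of corepresentations. -/
instance FinCorep.setoid : Setoid (FinCorep.{uk, uC, w} k C) where
  r V W := ∃ f : V.carrier ≃ₗ[k] W.carrier, IsColinear V.coact W.coact f.toLinearMap
  iseqv := ⟨fun _ => ⟨.refl _ _, IsColinear.id _⟩, fun ⟨f, hf⟩ => ⟨f.symm, hf.symm⟩,
    fun ⟨f, hf⟩ ⟨g, hg⟩ => ⟨f.trans g, hg.comp hf⟩⟩

/-- The direct sum of two corepresentations. -/
noncomputable def FinCorep.prod (V W : FinCorep.{uk, uC, w} k C) : FinCorep.{uk, uC, w} k C where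
  carrier := V.carrier × W.carrier
  coact := prodCoact V.coact W.coact
  isRightCoaction := V.isRightCoaction.prod W.isRightCoaction

/-- The zero corepresentation. -/
noncomputable def FinCorep.zero : FinCorep.{uk, uC, w} k C where
  carrier := PUnit
  coact := 0
  isRightCoaction := ⟨by simp, Subsingleton.elim _ _⟩

variable (k C) in
/-- Isomorphism classes of finite-dimensional corepresentations of `C`. -/
def CorepClass : Type (max uk uC (w + 1)) :=
  Quotient (FinCorep.setoid.{uk, uC, w} (k := k) (C := C))

/-- The direct sum of isomorphism classes. -/
noncomputable instance : Add (CorepClass.{uk, uC, w} k C) where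
  add := Quotient.map₂ FinCorep.prod
    fun _ _ ⟨f, hf⟩ _ _ ⟨g, hg⟩ => ⟨f.prodCongr g, prodCongr_colinear hf hg⟩

/-- The class of the zero corepresentation. -/
noncomputable instance : Zero (CorepClass.{uk, uC, w} k C) where
  zero := Quotient.mk _ FinCorep.zero

noncomputable instance : AddCommMonoid (CorepClass.{uk, uC, w} k C) where
  add_assoc := by
    rintro ⟨U⟩ ⟨V⟩ ⟨W⟩
    exact Quotient.sound ⟨LinearEquiv.prodAssoc k U.carrier V.carrier W.carrier,
      prodAssoc_colinear U.coact V.coact W.coact⟩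
  zero_add := by
    rintro ⟨V⟩
    exact Quotient.sound ⟨LinearEquiv.uniqueProd (M₂ := PUnit.{w + 1}),
      prod_colinear (V := PUnit.{w + 1}) (colinear_of_subsingleton _) (IsColinear.id V.coact)⟩
  add_zero := by
    rintro ⟨V⟩
    exact Quotient.sound ⟨LinearEquiv.prodUnique (M₂ := PUnit.{w + 1}),
      prod_colinear (W := PUnit.{w + 1}) (IsColinear.id V.coact) (colinear_of_subsingleton _)⟩
  add_comm := by
    rintro ⟨V⟩ ⟨W⟩
    exact Quotient.sound ⟨LinearEquiv.prodComm k V.carrier W.carrier,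
      prod_colinear (inr_colinear W.coact V.coact) (inl_colinear W.coact V.coact)⟩
  nsmul := nsmulRec

variable {P : Type uP} [Ring P] [Algebra k P] (δ : P →ₗ[k] P ⊗[k] C)

/-- The coinvariant subalgebra `B = {b | δ(bp) = b δ(p) for all p}`. -/
def coinv : Subalgebra k P where
  carrier := {b | ∀ p, δ (b * p) = (LinearMap.mulLeft k b).rTensor C (δ p)}
  mul_mem' {a b} ha hb p := by
    rw [mul_assoc, ha, hb, LinearMap.mulLeft_mul, LinearMap.rTensor_comp, LinearMap.comp_apply]
  add_mem' {a b} ha hb p := by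
    have : LinearMap.mulLeft k (a + b) = LinearMap.mulLeft k a + LinearMap.mulLeft k b := by
      ext; simp [add_mul]
    rw [add_mul, map_add, ha, hb, this, LinearMap.rTensor_add, LinearMap.add_apply]
  algebraMap_mem' r p := by
    have : LinearMap.mulLeft k (algebraMap k P r) = r • LinearMap.id := by
      ext; simp [Algebra.smul_def]
    rw [this, LinearMap.rTensor_smul, ← Algebra.smul_def]
    simp

/-- The submodule of `P ⊗ P` spanned by the elements `pb ⊗ q - p ⊗ bq` with `b ∈ B`. -/
def balancedRel (B : Subalgebra k P) : Submodule k (P ⊗[k] P) :=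
  Submodule.span k {x | ∃ p q : P, ∃ b ∈ B, x = (p * b) ⊗ₜ[k] q - p ⊗ₜ[k] (b * q)}

/-- The tensor product `P ⊗_B P` over the (noncommutative) subalgebra `B`. -/
abbrev BalTensor (B : Subalgebra k P) : Type _ := (P ⊗[k] P) ⧸ balancedRel B

/-- `P ⊗ P → P ⊗ C`, `p ⊗ q ↦ p δ(q)`. -/
noncomputable def canLift : P ⊗[k] P →ₗ[k] P ⊗[k] C :=
  (LinearMap.mul' k P).rTensor C ∘ₗ (TensorProduct.assoc k P P C).symm.toLinearMap ∘ₗ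
    δ.lTensor P

theorem canLift_tmul (p q : P) :
    canLift δ (p ⊗ₜ q) = (LinearMap.mulLeft k p).rTensor C (δ q) := by
  simp only [canLift, LinearMap.comp_apply, LinearMap.lTensor_tmul]
  generalize δ q = x
  induction x with
  | zero => simp
  | tmul a c => simp
  | add x y hx hy => rw [TensorProduct.tmul_add, map_add, map_add, map_add, hx, hy]

/-- The canonical map `P ⊗_B P → P ⊗ C`, `p ⊗_B q ↦ p δ(q)`. -/
noncomputable def can : BalTensor (coinv δ) →ₗ[k] P ⊗[k] C :=
  (balancedRel (coinv δ)).liftQ (canLift δ) <| by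
    rw [balancedRel, Submodule.span_le]
    rintro _ ⟨p, q, b, hb, rfl⟩
    rw [SetLike.mem_coe, LinearMap.mem_ker, map_sub, canLift_tmul, canLift_tmul, hb q,
      LinearMap.mulLeft_mul, LinearMap.rTensor_comp, LinearMap.comp_apply, sub_self]

/-- Right multiplication `x ⊗_B y ↦ x ⊗_B yp` on `P ⊗_B P`. -/
noncomputable def rmul (B : Subalgebra k P) (p : P) : BalTensor B →ₗ[k] BalTensor B :=
  (balancedRel B).mapQ (balancedRel B) ((LinearMap.mulRight k p).lTensor P) <| by
    rw [balancedRel, Submodule.span_le]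
    rintro _ ⟨x, y, b, hb, rfl⟩
    exact Submodule.subset_span ⟨x, y * p, b, hb, by simp [mul_assoc]⟩

variable {δ}

/-- The translation map `τ(c) = can⁻¹(1 ⊗ c)`. -/
noncomputable def translation (h : Function.Bijective (can δ)) : C →ₗ[k] BalTensor (coinv δ) :=
  (LinearEquiv.ofBijective (can δ) h).symm.toLinearMap ∘ₗ TensorProduct.mk k P C 1

/-- The canonical entwining `ψ(c ⊗ p) = can(can⁻¹(1 ⊗ c) p)`. -/
noncomputable def entwining (h : Function.Bijective (can δ)) : C ⊗[k] P →ₗ[k] P ⊗[k] C :=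
  TensorProduct.lift <| LinearMap.mk₂ k (fun c p => can δ (rmul (coinv δ) p (translation h c)))
    (fun c c' p => by simp only [map_add]) (fun r c p => by simp only [map_smul])
    (fun c p p' => by
      rw [← map_add]
      congr 1
      obtain ⟨t, ht⟩ := Submodule.Quotient.mk_surjective _ (translation h c)
      rw [← ht]
      have : LinearMap.mulRight k (p + p') = LinearMap.mulRight k p + LinearMap.mulRight k p' := by
        ext; simp [mul_add]
      simp only [rmul, Submodule.mapQ_apply, this, LinearMap.lTensor_add, LinearMap.add_apply,
        Submodule.Quotient.mk_add])
    (fun r c p => by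
      rw [← map_smul]
      congr 1
      obtain ⟨t, ht⟩ := Submodule.Quotient.mk_surjective _ (translation h c)
      rw [← ht]
      have : LinearMap.mulRight k (r • p) = r • LinearMap.mulRight k p := by
        ext; simp
      simp only [rmul, Submodule.mapQ_apply, this, LinearMap.lTensor_smul, LinearMap.smul_apply,
        Submodule.Quotient.mk_smul])

/-- `P` is `C`-equivariantly projective as a left module over `B = P^{co C}`: every `B`-linear
`C`-colinear map `f : P → N` lifts through every `B`-linear `C`-colinear surjection `π : M → N`
that is split as a `C`-comodule map. Here `M` and `N` are left `B`-modules and right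
`C`-comodules with `B`-linear coactions. -/
def IsEquivariantlyProjective (δ : P →ₗ[k] P ⊗[k] C) : Prop :=
  ∀ (M N : Type uP) [AddCommGroup M] [Module k M] [Module (coinv δ) M]
    [IsScalarTower k (coinv δ) M] [AddCommGroup N] [Module k N] [Module (coinv δ) N]
    [IsScalarTower k (coinv δ) N] (δM : M →ₗ[k] M ⊗[k] C) (δN : N →ₗ[k] N ⊗[k] C),
    IsRightCoaction δM → IsRightCoaction δN →
    (∀ (b : coinv δ) (x : M), δM (b • x) = b • δM x) →
    (∀ (b : coinv δ) (x : N), δN (b • x) = b • δN x) →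
    ∀ (π : M →ₗ[coinv δ] N) (f : P →ₗ[coinv δ] N), Function.Surjective π →
      IsColinear δM δN (π.restrictScalars k) → IsColinear δ δN (f.restrictScalars k) →
      (∃ s : N →ₗ[k] M, IsColinear δN δM s ∧ π.restrictScalars k ∘ₗ s = LinearMap.id) →
      ∃ g : P →ₗ[coinv δ] M, IsColinear δ δM (g.restrictScalars k) ∧ π ∘ₗ g = f

/-- `P`, with the coaction `δ`, is a principal `C`-extension of `B = P^{co C}`, co-augmented by
the group-like element `e`. -/
structure IsPrincipal (δ : P →ₗ[k] P ⊗[k] C) (e : C) : Prop where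
  coaction : IsRightCoaction δ
  galois : Function.Bijective (can δ)
  entwining_bijective : Function.Bijective (entwining galois)
  groupLike : IsGroupLikeElem k e
  coaugmented : ∀ p, δ p = entwining galois (e ⊗ₜ p)
  projective : IsEquivariantlyProjective δ

/-- The left coaction `p ↦ ψ⁻¹(p ⊗ e)`. -/
noncomputable def IsPrincipal.leftCoact {e : C} (h : IsPrincipal δ e) : P →ₗ[k] C ⊗[k] P :=
  (LinearEquiv.ofBijective (entwining h.galois) h.entwining_bijective).symm.toLinearMap ∘ₗ
    (TensorProduct.mk k P C).flip e

/-- A strong connection: a unital bicolinear lifting `ℓ : C → P ⊗ P` of the translation map. -/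
structure IsStrongConnection {e : C} (h : IsPrincipal δ e) (l : C →ₗ[k] P ⊗[k] P) : Prop where
  lift : (balancedRel (coinv δ)).mkQ ∘ₗ l = translation h.galois
  right_colinear : δ.lTensor P ∘ₗ l =
    (TensorProduct.assoc k P P C).toLinearMap ∘ₗ l.rTensor C ∘ₗ Coalgebra.comul (R := k)
  left_colinear : (TensorProduct.assoc k C P P).toLinearMap ∘ₗ h.leftCoact.rTensor P ∘ₗ l =
    l.lTensor C ∘ₗ Coalgebra.comul (R := k)
  unital : l e = 1 ⊗ₜ 1

variable (k C) in
/-- `R_f(C)`: the Grothendieck group of the finite-dimensional corepresentations of `C`. -/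
abbrev CorepGroup : Type (max uk uC (w + 1)) :=
  Algebra.GrothendieckAddGroup (CorepClass.{uk, uC, w} k C)

/-- The class `[φ]` in `R_f(C)`. -/
noncomputable def FinCorep.cls (V : FinCorep.{uk, uC, w} k C) : CorepGroup.{uk, uC, w} k C :=
  Algebra.GrothendieckAddGroup.of (Quotient.mk _ V : CorepClass.{uk, uC, w} k C)

variable (δ) in
/-- The left `B`-module `Hom^C(V, P)` of colinear maps, with `(b f)(v) = b f(v)`. -/
def colinearHom (V : FinCorep.{uk, uC, w} k C) : Submodule (coinv δ) (V.carrier →ₗ[k] P) where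
  carrier := {f | IsColinear V.coact δ f}
  add_mem' {f g} hf hg := by
    simp only [Set.mem_ofPred_eq, IsColinear] at *
    rw [LinearMap.comp_add, hf, hg, LinearMap.rTensor_add, LinearMap.add_comp]
  zero_mem' := by simp [IsColinear]
  smul_mem' b f hf := by
    have e : b • f = LinearMap.mulLeft k (b : P) ∘ₗ f := rfl
    simp only [Set.mem_ofPred_eq, IsColinear] at *
    ext v
    rw [e, LinearMap.rTensor_comp, LinearMap.comp_assoc, ← hf]
    exact b.2 (f v)

/-- The character `c_φ = ∑ eᵢᵢ ∈ C`, where `φ(eⱼ) = ∑ eᵢ ⊗ eᵢⱼ` in the basis `(eᵢ)`. -/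
noncomputable def FinCorep.character (V : FinCorep.{uk, uC, w} k C) {d : ℕ}
    (b : Module.Basis (Fin d) k V.carrier) : C :=
  ∑ i, TensorProduct.lid k C ((b.coord i).rTensor C (V.coact (b i)))

/-- `p ↦ (t ↦ p ⊗ t)` as a map `P → Hom(P^{⊗m}, P^{⊗(m+1)})`. -/
noncomputable def consTens (m : ℕ) : P →ₗ[k] Tens k P m →ₗ[k] Tens k P (m + 1) :=
  (PiTensorProduct.lift).toLinearMap ∘ₗ
    (PiTensorProduct.tprod k : MultilinearMap k (fun _ : Fin (m + 1) => P) _).curryLeft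

/-- `t ↦ (p ↦ t ⊗ p)` as a map `P^{⊗m} → Hom(P, P^{⊗(m+1)})`. -/
noncomputable def snocTens (m : ℕ) : Tens k P m →ₗ[k] P →ₗ[k] Tens k P (m + 1) :=
  PiTensorProduct.lift
    (PiTensorProduct.tprod k : MultilinearMap k (fun _ : Fin (m + 1) => P) _).curryRight

/-- The gluing map `(p ⊗ t ⊗ q) ⊗ (p' ⊗ q') ↦ p ⊗ (t ⊗ q p') ⊗ q'`. -/
noncomputable def joinTens (m : ℕ) :
    ((P ⊗[k] Tens k P m) ⊗[k] P) ⊗[k] (P ⊗[k] P) →ₗ[k] (P ⊗[k] Tens k P (m + 1)) ⊗[k] P :=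
  ((TensorProduct.lift (snocTens m)).lTensor P ∘ₗ
    (TensorProduct.assoc k P (Tens k P m) P).toLinearMap ∘ₗ
    (LinearMap.mul' k P).lTensor (P ⊗[k] Tens k P m) ∘ₗ
    (TensorProduct.assoc k (P ⊗[k] Tens k P m) P P).toLinearMap).rTensor P ∘ₗ
  (TensorProduct.assoc k ((P ⊗[k] Tens k P m) ⊗[k] P) P P).symm.toLinearMap

theorem joinTens_tmul (m : ℕ) (p q p' q' : P) (t : Tens k P m) :
    joinTens m (((p ⊗ₜ t) ⊗ₜ q) ⊗ₜ (p' ⊗ₜ q')) = (p ⊗ₜ[k] snocTens m t (q * p')) ⊗ₜ[k] q' := by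
  simp [joinTens]

/-- The closing map `p ⊗ t ⊗ q ↦ q p ⊗ t`. -/
noncomputable def closeTens (m : ℕ) : (P ⊗[k] Tens k P m) ⊗[k] P →ₗ[k] Tens k P (m + 1) :=
  TensorProduct.lift (consTens m) ∘ₗ (LinearMap.mul' k P).rTensor (Tens k P m) ∘ₗ
    (TensorProduct.assoc k P P (Tens k P m)).symm.toLinearMap ∘ₗ
    (TensorProduct.comm k (P ⊗[k] Tens k P m) P).toLinearMap

theorem closeTens_tmul (m : ℕ) (p q : P) (t : Tens k P m) :
    closeTens m ((p ⊗ₜ t) ⊗ₜ q) = consTens (k := k) m (q * p) t := by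
  simp [closeTens]

/-- With `l(c) = c^{<1>} ⊗ c^{<2>}`, the map
`c ↦ c₍₁₎^{<1>} ⊗ (c₍₁₎^{<2>} c₍₂₎^{<1>} ⊗ … ⊗ c₍ₘ₎^{<2>} c₍ₘ₊₁₎^{<1>}) ⊗ c₍ₘ₊₁₎^{<2>}`. -/
noncomputable def strand (l : C →ₗ[k] P ⊗[k] P) : (m : ℕ) → C →ₗ[k] (P ⊗[k] Tens k P m) ⊗[k] P
  | 0 => ((TensorProduct.mk k P (Tens k P 0)).flip (PiTensorProduct.tprod k Fin.elim0)).rTensor P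
      ∘ₗ l
  | m + 1 => joinTens m ∘ₗ TensorProduct.map (strand l m) l ∘ₗ Coalgebra.comul (R := k)

/-- The chain `c₍ₘ₊₁₎^{<2>} c₍₁₎^{<1>} ⊗ c₍₁₎^{<2>} c₍₂₎^{<1>} ⊗ … ⊗ c₍ₘ₎^{<2>} c₍ₘ₊₁₎^{<1>}` in
`P^{⊗(m+1)}`, where `l(c) = c^{<1>} ⊗ c^{<2>}`. -/
noncomputable def galoisChain (l : C →ₗ[k] P ⊗[k] P) (m : ℕ) : C →ₗ[k] Tens k P (m + 1) :=
  closeTens m ∘ₗ strand l m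

theorem consTens_tprod (m : ℕ) (p : P) (a : Fin m → P) :
    consTens m p (PiTensorProduct.tprod k a) =
      PiTensorProduct.tprod k (Fin.cons p a : Fin (m + 1) → P) := by
  simp [consTens]

theorem snocTens_tprod (m : ℕ) (p : P) (a : Fin m → P) :
    snocTens m (PiTensorProduct.tprod k a) p =
      PiTensorProduct.tprod k (Fin.snoc a p : Fin (m + 1) → P) := by
  simp [snocTens]

/-- The map `B^{⊗m} → P^{⊗m}` induced by the inclusion of a subalgebra. -/
noncomputable def inclTens (B : Subalgebra k P) (m : ℕ) : Tens k B m →ₗ[k] Tens k P m :=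
  PiTensorProduct.map fun _ => B.val.toLinearMap

end Principal
end ChernGalois

open ChernGalois

/-!
Write `B = P^{co C}`, `δ(p) = p₍₀₎ ⊗ p₍₁₎`, `ψ` for the entwining and `τ = can⁻¹(1 ⊗ -)` for the
translation map.

*Existence of strong connections.* A left `B`-linear map `σ : P → P ⊗ P` induces a left `P`-linear
map `P ⊗_B P → P ⊗ P`, `p ⊗ q ↦ p σ(q)`, and `ℓ = (this map) ∘ τ` satisfies `p₍₀₎ ℓ(p₍₁₎) = σ(p)`
and `ℓ(e) = σ(1)`. Since the elements `p δ(q)` exhaust `P ⊗ C`, identities for `ℓ` may be checked on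
the elements `p₍₀₎ ⊗ p₍₁₎`: right colinearity of `ℓ` becomes that of `σ`, left colinearity becomes
the statement that `σ` takes its values in `B ⊗ P` (through `δ(pq) = p₍₀₎ ψ(p₍₁₎ ⊗ q)`,
`coaction_mul`), and `ℓ` lifts `τ` when `σ` comes from a section of the multiplication `B ⊗ P → P`.
Equivariant projectivity provides such a section `s`, with possibly `s(1) ≠ 1 ⊗ 1`. It is normalized
as follows: `s` yields a left `B`-linear retraction `f : P → B` and a colinear map `β : C → P` with
`β(e) = 1`; then `g(p) = f(p₍₀₎) ⊗ β(p₍₁₎)` is `B`-linear and colinear with `g(1) = 1 ⊗ 1`, and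
`g + s - s ∘ m ∘ g`, with `m` the multiplication, is a section with value `1 ⊗ 1` at `1`
(`IsPrincipal.exists_unital_section`).

*The formula.* For matrix coefficients `eᵢⱼ` of a corepresentation `V`, right colinearity of `ℓ`
allows one to write `ℓ(eᵢⱼ) = ∑ qᵢₐ ⊗ yₐ(eⱼ)` with finitely many linearly independent colinear maps
`yₐ : V → P` (`exists_connection_coeff`). Left colinearity and the independence of the `yₐ` show
that `f ↦ ∑ f(eⱼ) qⱼₐ` is `B`-valued on `Hom^C(V, P)`, and `c^{<1>} c^{<2>} = ε(c)` shows that these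
functionals and the `yₐ` form a dual basis (`IsStrongConnection.dualBasis`). Hence `Hom^C(V, P)` is
finitely generated projective, and its Chern character is the class of the generalized trace of the
idempotent matrix `E` with entries `E_{ab} = ∑ yₐ(eⱼ) q_{jb}`. On the other hand, as
`Δ(eᵢⱼ) = ∑ eᵢₛ ⊗ eₛⱼ`, the inner legs of the Chern–Galois chain of the character multiply up to the
entries of `E`, so that this chain equals the same generalized trace (`galoisChain_comulMatrix`).
Independence of the connection and of the basis is the independence of the Chern character of the
dual basis.
-/

namespace ChernGalois

set_option linter.unusedSectionVars false

/-! ### The canonical map and the entwining -/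

section FreeLift

variable {k : Type*} [Field k] {P : Type*} [Ring P] [Algebra k P]
  {X Y Z : Type*} [AddCommGroup X] [Module k X] [AddCommGroup Y] [Module k Y]
  [AddCommGroup Z] [Module k Z]

/-- The left `P`-linear extension `P ⊗ X → P ⊗ Y`, `p ⊗ x ↦ p σ(x)`, of a `k`-linear map
`σ : X → P ⊗ Y`. -/
noncomputable def freeLift (σ : X →ₗ[k] P ⊗[k] Y) : P ⊗[k] X →ₗ[k] P ⊗[k] Y :=
  (LinearMap.mul' k P).rTensor Y ∘ₗ (TensorProduct.assoc k P P Y).symm.toLinearMap ∘ₗ σ.lTensor P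

theorem freeLift_tmul (σ : X →ₗ[k] P ⊗[k] Y) (p : P) (x : X) :
    freeLift σ (p ⊗ₜ x) = (LinearMap.mulLeft k p).rTensor Y (σ x) := by
  simp only [freeLift, LinearMap.comp_apply, LinearMap.lTensor_tmul]
  generalize σ x = t
  induction t with
  | zero => simp
  | tmul a c => simp
  | add x y hx hy => rw [TensorProduct.tmul_add, map_add, map_add, map_add, hx, hy]

theorem rTensor_mulLeft_one (t : P ⊗[k] Y) : (LinearMap.mulLeft k (1 : P)).rTensor Y t = t := by
  rw [LinearMap.mulLeft_one, LinearMap.rTensor_id, LinearMap.id_apply]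

theorem freeLift_one_tmul (σ : X →ₗ[k] P ⊗[k] Y) (x : X) : freeLift σ (1 ⊗ₜ x) = σ x := by
  rw [freeLift_tmul, rTensor_mulLeft_one]

theorem freeLift_mulLeft (σ : X →ₗ[k] P ⊗[k] Y) (p : P) (t : P ⊗[k] X) :
    freeLift σ ((LinearMap.mulLeft k p).rTensor X t) =
      (LinearMap.mulLeft k p).rTensor Y (freeLift σ t) := by
  induction t with
  | zero => simp
  | tmul a c => simp [freeLift_tmul, LinearMap.mulLeft_mul, LinearMap.rTensor_comp]
  | add x y hx hy => simp only [map_add, hx, hy]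

/-- Two left `P`-linear maps agree if they agree on `1 ⊗ X`. -/
theorem eq_freeLift {g : P ⊗[k] X →ₗ[k] P ⊗[k] Y} {σ : X →ₗ[k] P ⊗[k] Y}
    (hg : ∀ p t, g ((LinearMap.mulLeft k p).rTensor X t) =
      (LinearMap.mulLeft k p).rTensor Y (g t))
    (h : ∀ x, g (1 ⊗ₜ x) = σ x) : g = freeLift σ := by
  ext p x
  have := hg p (1 ⊗ₜ x)
  rw [h] at this
  simpa [freeLift_tmul] using this

theorem freeLift_freeLift (τ : Y →ₗ[k] P ⊗[k] Z) (σ : X →ₗ[k] P ⊗[k] Y) (t : P ⊗[k] X) :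
    freeLift τ (freeLift σ t) = freeLift (freeLift τ ∘ₗ σ) t := by
  refine LinearMap.congr_fun (eq_freeLift (g := freeLift τ ∘ₗ freeLift σ) (fun p t => ?_)
    fun x => ?_) t
  · simp only [LinearMap.comp_apply, freeLift_mulLeft]
  · simp only [LinearMap.comp_apply, freeLift_one_tmul]

theorem lTensor_freeLift (f : Y →ₗ[k] Z) (σ : X →ₗ[k] P ⊗[k] Y) (t : P ⊗[k] X) :
    f.lTensor P (freeLift σ t) = freeLift (f.lTensor P ∘ₗ σ) t := by
  refine LinearMap.congr_fun (eq_freeLift (g := f.lTensor P ∘ₗ freeLift σ) (fun p t => ?_)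
    fun x => ?_) t
  · simp only [LinearMap.comp_apply, freeLift_mulLeft]
    exact LinearMap.congr_fun ((LinearMap.lTensor_comp_rTensor _ _ _).trans
      (LinearMap.rTensor_comp_lTensor _ _ _).symm) _
  · simp only [LinearMap.comp_apply, freeLift_one_tmul]

theorem mkQ_mulLeft_congr (B : Subalgebra k P) (p : P) {t t' : P ⊗[k] P}
    (h : (balancedRel B).mkQ t = (balancedRel B).mkQ t') :
    (balancedRel B).mkQ ((LinearMap.mulLeft k p).rTensor P t) =
      (balancedRel B).mkQ ((LinearMap.mulLeft k p).rTensor P t') := by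
  have hle : balancedRel B ≤ (balancedRel B).comap ((LinearMap.mulLeft k p).rTensor P) := by
    conv_lhs => rw [balancedRel]
    rw [Submodule.span_le]
    rintro _ ⟨x, y, b, hb, rfl⟩
    exact Submodule.subset_span ⟨p * x, y, b, hb, by simp [mul_assoc]⟩
  have := congrArg ((balancedRel B).mapQ (balancedRel B) _ hle) h
  simpa only [Submodule.mkQ_apply, Submodule.mapQ_apply] using this

/-- The map `P ⊗_B P → P ⊗ Y`, `p ⊗ q ↦ p σ(q)`, for a left `B`-linear map `σ`. -/
noncomputable def balLift (B : Subalgebra k P) (σ : P →ₗ[k] P ⊗[k] Y)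
    (hσ : ∀ b ∈ B, ∀ p, σ (b * p) = (LinearMap.mulLeft k b).rTensor Y (σ p)) :
    BalTensor B →ₗ[k] P ⊗[k] Y :=
  (balancedRel B).liftQ (freeLift σ) <| by
    rw [balancedRel, Submodule.span_le]
    rintro _ ⟨p, q, b, hb, rfl⟩
    rw [SetLike.mem_coe, LinearMap.mem_ker, map_sub, freeLift_tmul, freeLift_tmul, hσ b hb q,
      LinearMap.mulLeft_mul, LinearMap.rTensor_comp, LinearMap.comp_apply, sub_self]

theorem balLift_mkQ {B : Subalgebra k P} {σ : P →ₗ[k] P ⊗[k] Y}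
    (hσ : ∀ b ∈ B, ∀ p, σ (b * p) = (LinearMap.mulLeft k b).rTensor Y (σ p)) (t : P ⊗[k] P) :
    balLift B σ hσ ((balancedRel B).mkQ t) = freeLift σ t :=
  Submodule.liftQ_apply _ _ _

end FreeLift

section Entwining

variable {k : Type uk} [Field k] {C : Type uC} [AddCommGroup C] [Module k C] [Coalgebra k C]
  {P : Type uP} [Ring P] [Algebra k P] {δ : P →ₗ[k] P ⊗[k] C}

theorem can_mkQ (t : P ⊗[k] P) : can δ ((balancedRel (coinv δ)).mkQ t) = freeLift δ t :=
  Submodule.liftQ_apply _ _ _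

theorem freeLift_coaction_surjective (h : Function.Bijective (can δ)) :
    Function.Surjective (freeLift δ) := by
  intro t
  obtain ⟨u, rfl⟩ := h.2 t
  obtain ⟨s, rfl⟩ := Submodule.mkQ_surjective _ u
  exact ⟨s, (can_mkQ s).symm⟩

theorem can_translation (h : Function.Bijective (can δ)) (c : C) :
    can δ (translation h c) = 1 ⊗ₜ c :=
  (LinearEquiv.ofBijective (can δ) h).apply_symm_apply _

theorem entwining_tmul (h : Function.Bijective (can δ)) (c : C) (p : P) :
    entwining h (c ⊗ₜ p) = can δ (rmul (coinv δ) p (translation h c)) := by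
  simp [entwining]

theorem rmul_mkQ (B : Subalgebra k P) (p : P) (t : P ⊗[k] P) :
    rmul B p ((balancedRel B).mkQ t) = (balancedRel B).mkQ ((LinearMap.mulRight k p).lTensor P t) :=
  Submodule.mapQ_apply _ _ _ _

/-- The right action `(p ⊗ c) q = p ψ(c ⊗ q)` of `P` on `P ⊗ C`. -/
noncomputable def entwinedAct (h : Function.Bijective (can δ)) (q : P) :
    P ⊗[k] C →ₗ[k] P ⊗[k] C :=
  freeLift (entwining h ∘ₗ (TensorProduct.mk k C P).flip q)

theorem entwinedAct_tmul (h : Function.Bijective (can δ)) (q p : P) (c : C) :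
    entwinedAct h q (p ⊗ₜ c) = (LinearMap.mulLeft k p).rTensor C (entwining h (c ⊗ₜ q)) :=
  freeLift_tmul _ _ _

/-- The canonical map carries right multiplication to the entwined right action. -/
theorem can_rmul (h : Function.Bijective (can δ)) (q : P) (u : BalTensor (coinv δ)) :
    can δ (rmul (coinv δ) q u) = entwinedAct h q (can δ u) := by
  -- Both sides are left `P`-linear functions of `can u`, and they agree at `1 ⊗ c`.
  let E := LinearEquiv.ofBijective (can δ) h
  have hE : ∀ t, can δ (E.symm t) = t := E.apply_symm_apply
  have key : can δ ∘ₗ rmul (coinv δ) q ∘ₗ E.symm.toLinearMap = entwinedAct h q := by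
    refine eq_freeLift (fun p t => ?_) fun c => ?_
    · obtain ⟨s, rfl⟩ := freeLift_coaction_surjective h t
      have e1 : ∀ s, E.symm (freeLift δ s) = (balancedRel (coinv δ)).mkQ s := fun s => by
        rw [← can_mkQ]; exact E.symm_apply_apply _
      simp only [LinearMap.comp_apply, LinearEquiv.coe_coe]
      rw [← freeLift_mulLeft, e1, e1, rmul_mkQ, rmul_mkQ, can_mkQ, can_mkQ, ← freeLift_mulLeft]
      congr 1
      exact LinearMap.congr_fun ((LinearMap.lTensor_comp_rTensor _ _ _).trans
        (LinearMap.rTensor_comp_lTensor _ _ _).symm) _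
    · simp only [LinearMap.comp_apply, LinearMap.flip_apply, TensorProduct.mk_apply,
        entwining_tmul]
      rfl
  rw [← key]
  simp only [LinearMap.comp_apply, LinearEquiv.coe_coe]
  congr 2
  exact (E.symm_apply_apply u).symm

/-- `δ(pq) = p₍₀₎ ψ(p₍₁₎ ⊗ q)`. -/
theorem coaction_mul (h : Function.Bijective (can δ)) (p q : P) :
    δ (p * q) = entwinedAct h q (δ p) := by
  have := can_rmul h q ((balancedRel (coinv δ)).mkQ (1 ⊗ₜ p))
  rw [rmul_mkQ, can_mkQ, can_mkQ, freeLift_one_tmul] at this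
  simpa [freeLift_one_tmul] using this

theorem entwining_one (h : Function.Bijective (can δ)) (c : C) :
    entwining h (c ⊗ₜ 1) = 1 ⊗ₜ c := by
  rw [entwining_tmul, ← can_translation h c]
  congr 1
  obtain ⟨t, ht⟩ := Submodule.mkQ_surjective _ (translation h c)
  rw [← ht, rmul_mkQ, LinearMap.mulRight_one, LinearMap.lTensor_id, LinearMap.id_apply]

variable {e : C} (hP : IsPrincipal δ e)
include hP

theorem IsPrincipal.coaction_one : δ 1 = 1 ⊗ₜ e := by
  rw [hP.coaugmented, entwining_one]

/-- The coinvariants are the elements on which the coaction is trivial with respect to `e`. -/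
theorem IsPrincipal.mem_coinv_iff {p : P} : p ∈ coinv δ ↔ δ p = p ⊗ₜ e := by
  constructor
  · intro h
    have := h 1
    rwa [mul_one, hP.coaction_one, LinearMap.rTensor_tmul, LinearMap.mulLeft_apply, mul_one]
      at this
  · intro h q
    rw [coaction_mul hP.galois, h, entwinedAct_tmul, ← hP.coaugmented]

theorem IsPrincipal.entwining_leftCoact (p : P) :
    entwining hP.galois (hP.leftCoact p) = p ⊗ₜ e :=
  (LinearEquiv.ofBijective (entwining hP.galois) hP.entwining_bijective).apply_symm_apply _

theorem IsPrincipal.translation_groupLike :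
    translation hP.galois e = (balancedRel (coinv δ)).mkQ (1 ⊗ₜ 1) := by
  apply hP.galois.1
  rw [can_translation, can_mkQ, freeLift_one_tmul, hP.coaction_one]

end Entwining

/-! ### Strong connections from left linear maps -/

section FreeLiftComul

variable {k : Type*} [Field k] {P : Type*} [Ring P] [Algebra k P]
  {X Y Z W : Type*} [AddCommGroup X] [Module k X] [AddCommGroup Y] [Module k Y]
  [AddCommGroup Z] [Module k Z] [AddCommGroup W] [Module k W]

theorem freeLift_comp (σ : Y →ₗ[k] P ⊗[k] Z) (f : X →ₗ[k] Y) (t : P ⊗[k] X) :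
    freeLift (σ ∘ₗ f) t = freeLift σ (f.lTensor P t) := by
  induction t with
  | zero => simp
  | tmul a c => simp [freeLift_tmul]
  | add x y hx hy => simp only [map_add, hx, hy]

theorem freeLift_assoc_rTensor (σ : X →ₗ[k] P ⊗[k] Y) (t : P ⊗[k] (X ⊗[k] W)) :
    freeLift ((TensorProduct.assoc k P Y W).toLinearMap ∘ₗ σ.rTensor W) t =
      TensorProduct.assoc k P Y W ((freeLift σ).rTensor W
        ((TensorProduct.assoc k P X W).symm t)) := by
  refine (LinearMap.congr_fun (?_ : freeLift _ = (TensorProduct.assoc k P Y W).toLinearMap ∘ₗ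
    (freeLift σ).rTensor W ∘ₗ (TensorProduct.assoc k P X W).symm.toLinearMap) t)
  ext p x w
  simp only [TensorProduct.AlgebraTensorModule.curry_apply, LinearMap.restrictScalars_self,
    TensorProduct.curry_apply, LinearMap.comp_apply, LinearEquiv.coe_coe,
    TensorProduct.assoc_symm_tmul, LinearMap.rTensor_tmul, freeLift_tmul]
  generalize σ x = y
  induction y with
  | zero => simp
  | tmul a c => simp
  | add x y hx hy => simp only [map_add, TensorProduct.add_tmul, hx, hy]

end FreeLiftComul

section Connection

variable {k : Type uk} [Field k] {C : Type uC} [AddCommGroup C] [Module k C] [Coalgebra k C]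
  {P : Type uP} [Ring P] [Algebra k P] {δ : P →ₗ[k] P ⊗[k] C}

/-- The lifting `c ↦ c^{[1]} σ(c^{[2]})` of the translation map `τ(c) = c^{[1]} ⊗ c^{[2]}`
given by a left `B`-linear map `σ : P → P ⊗ P`. -/
noncomputable def connection (h : Function.Bijective (can δ)) (σ : P →ₗ[k] P ⊗[k] P)
    (hσ : ∀ b ∈ coinv δ, ∀ p, σ (b * p) = (LinearMap.mulLeft k b).rTensor P (σ p)) :
    C →ₗ[k] P ⊗[k] P :=
  balLift (coinv δ) σ hσ ∘ₗ translation h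

variable (h : Function.Bijective (can δ)) {σ : P →ₗ[k] P ⊗[k] P}
  (hσ : ∀ b ∈ coinv δ, ∀ p, σ (b * p) = (LinearMap.mulLeft k b).rTensor P (σ p))

theorem freeLift_connection (t : P ⊗[k] P) :
    freeLift (connection h σ hσ) (freeLift δ t) = freeLift σ t := by
  let E := LinearEquiv.ofBijective (can δ) h
  have e1 : ∀ s, E.symm (freeLift δ s) = (balancedRel (coinv δ)).mkQ s := fun s => by
    rw [← can_mkQ]; exact E.symm_apply_apply _
  have key : balLift (coinv δ) σ hσ ∘ₗ E.symm.toLinearMap = freeLift (connection h σ hσ) := by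
    refine eq_freeLift (fun p t => ?_) fun c => rfl
    obtain ⟨s, rfl⟩ := freeLift_coaction_surjective h t
    simp only [LinearMap.comp_apply, LinearEquiv.coe_coe]
    rw [← freeLift_mulLeft, e1, e1, balLift_mkQ, balLift_mkQ, freeLift_mulLeft]
  rw [← key, LinearMap.comp_apply, LinearEquiv.coe_coe, e1, balLift_mkQ]

/-- `p₍₀₎ ℓ(p₍₁₎) = σ(p)`. -/
theorem freeLift_connection_coaction (p : P) :
    freeLift (connection h σ hσ) (δ p) = σ p := by
  simpa only [freeLift_one_tmul] using freeLift_connection h hσ (1 ⊗ₜ p)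

/-- To identify a map on `C` with values in `P ⊗ Y` with the composite of `ℓ` and a left
`P`-linear map `id ⊗ f`, it suffices to check on the elements `p₍₀₎ ⊗ p₍₁₎`. -/
theorem eq_lTensor_connection {Y : Type*} [AddCommGroup Y] [Module k Y] {g : C →ₗ[k] P ⊗[k] Y}
    {f : P →ₗ[k] Y} (hg : ∀ p, freeLift g (δ p) = f.lTensor P (σ p)) :
    g = f.lTensor P ∘ₗ connection h σ hσ := by
  ext c
  obtain ⟨s, hs⟩ := freeLift_coaction_surjective h (1 ⊗ₜ[k] c)
  have e : freeLift g ∘ₗ δ = f.lTensor P ∘ₗ σ := LinearMap.ext hg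
  rw [LinearMap.comp_apply, ← freeLift_one_tmul g, ← freeLift_one_tmul (connection h σ hσ), ← hs,
    freeLift_connection, lTensor_freeLift, freeLift_freeLift, e]

theorem connection_right_colinear (hδ : IsRightCoaction δ)
    (hcol : δ.lTensor P ∘ₗ σ = (TensorProduct.assoc k P P C).toLinearMap ∘ₗ σ.rTensor C ∘ₗ δ) :
    δ.lTensor P ∘ₗ connection h σ hσ = (TensorProduct.assoc k P P C).toLinearMap ∘ₗ
      (connection h σ hσ).rTensor C ∘ₗ Coalgebra.comul (R := k) := by
  refine (eq_lTensor_connection h hσ fun p => ?_).symm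
  have e : freeLift (connection h σ hσ) ∘ₗ δ = σ :=
    LinearMap.ext (freeLift_connection_coaction h hσ)
  have h1 := LinearMap.congr_fun hδ.coassoc p
  have h2 := LinearMap.congr_fun hcol p
  simp only [LinearMap.comp_apply, LinearEquiv.coe_coe] at h1 h2
  rw [← LinearMap.comp_assoc, freeLift_comp, freeLift_assoc_rTensor, ← h1,
    LinearEquiv.symm_apply_apply, ← LinearMap.comp_apply (LinearMap.rTensor C _),
    ← LinearMap.rTensor_comp, e, h2]

/-- `ℓ` lifts the translation map, provided `σ(p)` represents `1 ⊗_B p`. -/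
theorem connection_lift (hmul : ∀ p, (balancedRel (coinv δ)).mkQ (σ p) =
      (balancedRel (coinv δ)).mkQ (1 ⊗ₜ p)) :
    (balancedRel (coinv δ)).mkQ ∘ₗ connection h σ hσ = translation h := by
  ext c
  obtain ⟨t, ht⟩ := Submodule.mkQ_surjective _ (translation h c)
  rw [LinearMap.comp_apply, connection, LinearMap.comp_apply, ← ht, balLift_mkQ]
  clear ht
  induction t with
  | zero => simp
  | tmul p q =>
    rw [freeLift_tmul, mkQ_mulLeft_congr _ p (hmul q)]
    simp
  | add x y hx hy => simp only [map_add, hx, hy]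

variable {e : C} (hP : IsPrincipal δ e)

/-- Left colinearity of `ℓ`, with the left coaction expressed through the entwining:
`ψ(c₍₁₎ ⊗ c₍₂₎^{<1>}) ⊗ c₍₂₎^{<2>} = c^{<1>} ⊗ e ⊗ c^{<2>}`. -/
theorem left_colinear_iff (l : C →ₗ[k] P ⊗[k] P) :
    (TensorProduct.assoc k C P P).toLinearMap ∘ₗ hP.leftCoact.rTensor P ∘ₗ l =
      l.lTensor C ∘ₗ Coalgebra.comul (R := k) ↔
    (entwining hP.galois).rTensor P ∘ₗ (TensorProduct.assoc k C P P).symm.toLinearMap ∘ₗ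
      l.lTensor C ∘ₗ Coalgebra.comul (R := k) =
        ((TensorProduct.mk k P C).flip e).rTensor P ∘ₗ l := by
  have e1 : ∀ t, (entwining hP.galois).rTensor P (hP.leftCoact.rTensor P t) =
      ((TensorProduct.mk k P C).flip e).rTensor P t := fun t => by
    rw [← LinearMap.comp_apply, ← LinearMap.rTensor_comp]
    congr 2
    ext p
    exact hP.entwining_leftCoact p
  have inj : Function.Injective ((entwining hP.galois).rTensor P) :=
    (TensorProduct.congr (LinearEquiv.ofBijective _ hP.entwining_bijective)
      (LinearEquiv.refl k P)).injective
  constructor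
  · intro hl
    ext c
    have := LinearMap.congr_fun hl c
    simp only [LinearMap.comp_apply, LinearEquiv.coe_coe] at this ⊢
    rw [← this, LinearEquiv.symm_apply_apply, e1]
  · intro hl
    ext c
    have := LinearMap.congr_fun hl c
    simp only [LinearMap.comp_apply, LinearEquiv.coe_coe] at this ⊢
    rw [← e1] at this
    rw [← inj this, LinearEquiv.apply_symm_apply]

/-- Left colinearity of `ℓ`: on `p₍₀₎ ⊗ p₍₁₎` the required identity becomes
`δ(x) ⊗ y = x ⊗ e ⊗ y` for `σ(p) = x ⊗ y`, which holds as `x ∈ B`. -/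
theorem connection_left_colinear
    (hB : ∀ p, σ p ∈ LinearMap.range ((coinv δ).val.toLinearMap.rTensor P)) :
    (TensorProduct.assoc k C P P).toLinearMap ∘ₗ hP.leftCoact.rTensor P ∘ₗ
        connection hP.galois σ hσ =
      (connection hP.galois σ hσ).lTensor C ∘ₗ Coalgebra.comul (R := k) := by
  rw [left_colinear_iff]
  set l := connection hP.galois σ hσ with hl
  let M₀ : C ⊗[k] (P ⊗[k] P) →ₗ[k] P ⊗[k] (C ⊗[k] P) := (TensorProduct.assoc k P C P).toLinearMap ∘ₗ
    (entwining hP.galois).rTensor P ∘ₗ (TensorProduct.assoc k C P P).symm.toLinearMap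
  let M : C ⊗[k] C →ₗ[k] P ⊗[k] (C ⊗[k] P) := M₀ ∘ₗ l.lTensor C
  have hM₀ : ∀ p (t : P ⊗[k] P), freeLift M₀ (TensorProduct.assoc k P C (P ⊗[k] P) (δ p ⊗ₜ t)) =
      TensorProduct.assoc k P C P (δ.rTensor P ((LinearMap.mulLeft k p).rTensor P t)) := by
    intro p t
    induction t with
    | zero => simp
    | add x y hx hy => simp only [map_add, TensorProduct.tmul_add, hx, hy]
    | tmul a b =>
      rw [LinearMap.rTensor_tmul, LinearMap.mulLeft_apply, LinearMap.rTensor_tmul,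
        coaction_mul hP.galois]
      generalize δ p = x
      induction x with
      | zero => simp
      | add x y hx hy => simp only [map_add, TensorProduct.add_tmul, hx, hy]
      | tmul p c =>
        rw [entwinedAct_tmul, TensorProduct.assoc_tmul, freeLift_tmul]
        simp only [M₀, LinearMap.comp_apply, LinearEquiv.coe_coe, TensorProduct.assoc_symm_tmul,
          LinearMap.rTensor_tmul]
        generalize entwining hP.galois (c ⊗ₜ a) = y
        induction y with
        | zero => simp
        | tmul a c => simp
        | add x y hx hy => simp only [map_add, TensorProduct.add_tmul, hx, hy]
  have hM : ∀ y : P ⊗[k] C, freeLift M (TensorProduct.assoc k P C C (δ.rTensor C y)) =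
      TensorProduct.assoc k P C P (δ.rTensor P (freeLift l y)) := by
    intro y
    induction y with
    | zero => simp
    | add x y hx hy => simp only [map_add, hx, hy]
    | tmul p c =>
      rw [freeLift_tmul, ← hM₀, freeLift_comp, LinearMap.rTensor_tmul]
      congr 1
      generalize δ p = x
      induction x with
      | zero => simp
      | tmul a c => simp
      | add x y hx hy => simp only [map_add, TensorProduct.add_tmul, hx, hy]
  have key : M ∘ₗ Coalgebra.comul (R := k) = (TensorProduct.mk k C P e).lTensor P ∘ₗ l := by
    refine eq_lTensor_connection hP.galois hσ fun p => ?_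
    have h1 := LinearMap.congr_fun hP.coaction.coassoc p
    simp only [LinearMap.comp_apply, LinearEquiv.coe_coe] at h1
    rw [freeLift_comp, ← h1, hM, hl, freeLift_connection_coaction]
    obtain ⟨t, ht⟩ := hB p
    rw [← ht]
    clear ht
    induction t with
    | zero => simp
    | tmul b q => simp [hP.mem_coinv_iff.1 b.2]
    | add x y hx hy => simp only [map_add, hx, hy]
  ext c
  have := LinearMap.congr_fun key c
  simp only [LinearMap.comp_apply, LinearEquiv.coe_coe, M, M₀] at this ⊢
  apply (TensorProduct.assoc k P C P).injective
  rw [this]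
  generalize l c = t
  induction t with
  | zero => simp
  | tmul b q => simp
  | add x y hx hy => simp only [map_add, hx, hy]

theorem connection_groupLike : connection hP.galois σ hσ e = σ 1 := by
  rw [connection, LinearMap.comp_apply, hP.translation_groupLike, balLift_mkQ, freeLift_one_tmul]

end Connection

/-! ### Unital sections of the multiplication `B ⊗ P → P` -/

section Sections

variable {k : Type uk} [Field k] {C : Type uC} [AddCommGroup C] [Module k C] [Coalgebra k C]
  {P : Type uP} [Ring P] [Algebra k P] {δ : P →ₗ[k] P ⊗[k] C}

/-- The coaction on the second factor of `X ⊗ P`. -/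
noncomputable def freeCoact (δ : P →ₗ[k] P ⊗[k] C) (X : Type*) [AddCommGroup X] [Module k X] :
    X ⊗[k] P →ₗ[k] (X ⊗[k] P) ⊗[k] C :=
  (TensorProduct.assoc k X P C).symm.toLinearMap ∘ₗ δ.lTensor X

theorem mk_colinear_freeCoact {X : Type*} [AddCommGroup X] [Module k X] (x : X) :
    IsColinear δ (freeCoact δ X) (TensorProduct.mk k X P x) := by
  ext p
  simp only [freeCoact, LinearMap.comp_apply, LinearEquiv.coe_coe, TensorProduct.mk_apply,
    LinearMap.lTensor_tmul]
  generalize δ p = t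
  induction t with
  | zero => simp
  | tmul a c => simp
  | add x y hx hy => simp only [map_add, TensorProduct.tmul_add, hx, hy]

theorem isRightCoaction_freeCoact (hδ : IsRightCoaction δ) (X : Type*) [AddCommGroup X]
    [Module k X] : IsRightCoaction (freeCoact δ X) where
  coassoc := TensorProduct.ext <| LinearMap.ext fun x =>
    (hδ.of_colinear (mk_colinear_freeCoact x)).1
  counit := TensorProduct.ext <| LinearMap.ext fun x =>
    (hδ.of_colinear (mk_colinear_freeCoact x)).2

theorem coinv_smul_eq (b : coinv δ) {Y : Type*} [AddCommGroup Y] [Module k Y] (t : P ⊗[k] Y) :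
    b • t = (LinearMap.mulLeft k (b : P)).rTensor Y t := by
  induction t with
  | zero => simp
  | tmul a c => rfl
  | add x y hx hy => simp only [map_add, smul_add, hx, hy]

theorem coaction_smul (b : coinv δ) (p : P) : δ (b • p) = b • δ p := by
  rw [coinv_smul_eq]
  exact b.2 p

/-- The coaction on `B ⊗ P` is left `B`-linear. -/
theorem freeCoact_smul (b : coinv δ) (x : coinv δ ⊗[k] P) :
    freeCoact δ (coinv δ) (b • x) = b • freeCoact δ (coinv δ) x := by
  induction x with
  | zero => simp
  | add x y hx hy => simp only [map_add, smul_add, hx, hy]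
  | tmul a p =>
    simp only [freeCoact, LinearMap.comp_apply, LinearEquiv.coe_coe, LinearMap.lTensor_tmul,
      TensorProduct.smul_tmul']
    generalize δ p = t
    induction t with
    | zero => simp
    | tmul a c => simp [TensorProduct.smul_tmul']
    | add x y hx hy => simp only [map_add, smul_add, TensorProduct.tmul_add, hx, hy]

theorem IsColinear.restrictScalars_add {B V W : Type*} [Ring B] [AddCommGroup V] [Module k V]
    [AddCommGroup W] [Module k W] [Module B V] [Module B W] [Algebra k B] [IsScalarTower k B V]
    [IsScalarTower k B W] {δV : V →ₗ[k] V ⊗[k] C} {δW : W →ₗ[k] W ⊗[k] C} {f g : V →ₗ[B] W}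
    (hf : IsColinear δV δW (f.restrictScalars k)) (hg : IsColinear δV δW (g.restrictScalars k)) :
    IsColinear δV δW ((f + g).restrictScalars k) := by
  have e : (f + g).restrictScalars k = f.restrictScalars k + g.restrictScalars k := rfl
  unfold IsColinear at *
  rw [e, LinearMap.comp_add, hf, hg, LinearMap.rTensor_add, LinearMap.add_comp]

theorem IsColinear.restrictScalars_sub {B V W : Type*} [Ring B] [AddCommGroup V] [Module k V]
    [AddCommGroup W] [Module k W] [Module B V] [Module B W] [Algebra k B] [IsScalarTower k B V]
    [IsScalarTower k B W] {δV : V →ₗ[k] V ⊗[k] C} {δW : W →ₗ[k] W ⊗[k] C} {f g : V →ₗ[B] W}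
    (hf : IsColinear δV δW (f.restrictScalars k)) (hg : IsColinear δV δW (g.restrictScalars k)) :
    IsColinear δV δW ((f - g).restrictScalars k) := by
  have e : (f - g).restrictScalars k = f.restrictScalars k - g.restrictScalars k := rfl
  unfold IsColinear at *
  rw [e, LinearMap.comp_sub, hf, hg, LinearMap.rTensor_sub, LinearMap.sub_comp]

/-- The left `B`-linear extension `B ⊗ P → N`, `b ⊗ p ↦ b φ(p)`, of a `k`-linear map `φ`. -/
noncomputable def coinvLift {N : Type*} [AddCommGroup N] [Module k N] [Module (coinv δ) N]
    [IsScalarTower k (coinv δ) N] (φ : P →ₗ[k] N) : coinv δ ⊗[k] P →ₗ[coinv δ] N where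
  toFun := TensorProduct.lift ((Algebra.lsmul k k N).toLinearMap.compl₂ φ)
  map_add' := map_add _
  map_smul' b t := by
    induction t with
    | zero => simp
    | tmul a p => simp [TensorProduct.smul_tmul']
    | add x y hx hy => simp only [map_add, smul_add, hx, hy]

theorem coinvLift_tmul {N : Type*} [AddCommGroup N] [Module k N] [Module (coinv δ) N]
    [IsScalarTower k (coinv δ) N] (φ : P →ₗ[k] N) (b : coinv δ) (p : P) :
    coinvLift φ (b ⊗ₜ p) = b • φ p := by
  simp [coinvLift]

variable (δ) in
/-- The multiplication `B ⊗ P → P`. -/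
noncomputable def coinvMul : coinv δ ⊗[k] P →ₗ[coinv δ] P :=
  coinvLift LinearMap.id

theorem coinvMul_tmul (b : coinv δ) (p : P) : coinvMul δ (b ⊗ₜ p) = b * p :=
  coinvLift_tmul _ _ _

theorem coinvMul_colinear :
    IsColinear (freeCoact δ (coinv δ)) δ ((coinvMul δ).restrictScalars k) := by
  refine TensorProduct.ext' fun b p => ?_
  simp only [LinearMap.comp_apply, freeCoact, LinearEquiv.coe_coe, LinearMap.lTensor_tmul,
    LinearMap.restrictScalars_apply, coinvMul_tmul]
  rw [b.2 p]
  generalize δ p = t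
  induction t with
  | zero => simp
  | tmul a c => simp [coinvMul_tmul]
  | add x y hx hy => simp only [map_add, TensorProduct.tmul_add, hx, hy]

/-- Left `B`-linearity of a section `s : P → B ⊗ P`, regarded as a map `P → P ⊗ P`. -/
theorem section_rTensor_mul (s : P →ₗ[coinv δ] coinv δ ⊗[k] P) (b : P) (hb : b ∈ coinv δ) (p : P) :
    ((coinv δ).val.toLinearMap.rTensor P ∘ₗ s.restrictScalars k) (b * p) =
      (LinearMap.mulLeft k b).rTensor P
        (((coinv δ).val.toLinearMap.rTensor P ∘ₗ s.restrictScalars k) p) := by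
  have h1 := s.map_smul ⟨b, hb⟩ p
  rw [Subalgebra.smul_def, smul_eq_mul] at h1
  simp only [LinearMap.comp_apply, LinearMap.restrictScalars_apply, h1]
  generalize s p = t
  induction t with
  | zero => simp
  | tmul a c => simp [TensorProduct.smul_tmul']
  | add x y hx hy => simp only [map_add, smul_add, hx, hy]

/-- Right colinearity of a section `s : P → B ⊗ P`, regarded as a map `P → P ⊗ P`. -/
theorem section_rTensor_colinear {s : P →ₗ[coinv δ] coinv δ ⊗[k] P}
    (hs : IsColinear δ (freeCoact δ (coinv δ)) (s.restrictScalars k)) :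
    δ.lTensor P ∘ₗ ((coinv δ).val.toLinearMap.rTensor P ∘ₗ s.restrictScalars k) =
      (TensorProduct.assoc k P P C).toLinearMap ∘ₗ
        ((coinv δ).val.toLinearMap.rTensor P ∘ₗ s.restrictScalars k).rTensor C ∘ₗ δ := by
  have e1 : δ.lTensor P ∘ₗ (coinv δ).val.toLinearMap.rTensor P =
      (TensorProduct.assoc k P P C).toLinearMap ∘ₗ
        ((coinv δ).val.toLinearMap.rTensor P).rTensor C ∘ₗ freeCoact δ (coinv δ) := by
    refine TensorProduct.ext' fun b p => ?_
    simp only [LinearMap.comp_apply, freeCoact, LinearEquiv.coe_coe, LinearMap.lTensor_tmul,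
      LinearMap.rTensor_tmul]
    generalize δ p = t
    induction t with
    | zero => simp
    | tmul a c => simp
    | add x y hx hy => simp only [map_add, TensorProduct.tmul_add, hx, hy]
  unfold IsColinear at hs
  rw [← LinearMap.comp_assoc, e1, LinearMap.comp_assoc, LinearMap.comp_assoc, hs,
    LinearMap.rTensor_comp, LinearMap.comp_assoc]

/-- Equivariant projectivity splits the multiplication `B ⊗ P → P`. -/
theorem exists_section (hδ : IsRightCoaction δ) (h : IsEquivariantlyProjective δ) :
    ∃ s : P →ₗ[coinv δ] coinv δ ⊗[k] P,
      IsColinear δ (freeCoact δ (coinv δ)) (s.restrictScalars k) ∧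
      coinvMul δ ∘ₗ s = LinearMap.id := by
  refine h (coinv δ ⊗[k] P) P (freeCoact δ (coinv δ)) δ (isRightCoaction_freeCoact hδ _) hδ
    freeCoact_smul coaction_smul (coinvMul δ) LinearMap.id (fun p => ⟨1 ⊗ₜ p, ?_⟩)
    coinvMul_colinear (IsColinear.id δ) ⟨TensorProduct.mk k _ _ 1, mk_colinear_freeCoact 1, ?_⟩
  · simp [coinvMul_tmul]
  · ext p
    simp [coinvMul_tmul]

/-- Over a field every linear map has a generalized inverse. -/
theorem exists_generalized_inverse {K V W : Type*} [Field K] [AddCommGroup V] [Module K V]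
    [AddCommGroup W] [Module K W] (D : V →ₗ[K] W) : ∃ g : W →ₗ[K] V, D ∘ₗ g ∘ₗ D = D := by
  obtain ⟨r, hr⟩ := D.rangeRestrict.exists_rightInverse_of_surjective D.range_rangeRestrict
  obtain ⟨g, hg⟩ := r.exists_extend
  refine ⟨g, LinearMap.ext fun p => ?_⟩
  have h1 := LinearMap.congr_fun hg (D.rangeRestrict p)
  have h2 := congrArg Subtype.val (LinearMap.congr_fun hr (D.rangeRestrict p))
  simp only [LinearMap.comp_apply, Submodule.subtype_apply, LinearMap.id_apply] at h1 h2
  rw [← h1] at h2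
  exact h2

variable {e : C} (hP : IsPrincipal δ e)
include hP

/-- A `k`-linear retraction `F : P → B`. It is adapted to the description of `B` as the kernel of
`p ↦ δ(p) - p ⊗ e`, so that `id ⊗ F` visibly fixes the elements of `B ⊗ P` which that map kills in
the second factor. -/
theorem IsPrincipal.exists_retraction : ∃ F : P →ₗ[k] coinv δ, (∀ b : coinv δ, F b = b) ∧
    ∀ t : coinv δ ⊗[k] P, δ.lTensor _ t = ((TensorProduct.mk k P C).flip e).lTensor _ t →
      ((coinv δ).val.toLinearMap ∘ₗ F).lTensor _ t = t := by
  set D : P →ₗ[k] P ⊗[k] C := δ - (TensorProduct.mk k P C).flip e with hD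
  have hmem : ∀ p, p ∈ coinv δ ↔ D p = 0 := fun p => by
    rw [hP.mem_coinv_iff, hD, LinearMap.sub_apply, sub_eq_zero]; rfl
  obtain ⟨g, hg⟩ := exists_generalized_inverse D
  have hDg : ∀ p, D (g (D p)) = D p := LinearMap.congr_fun hg
  refine ⟨LinearMap.codRestrict (Subalgebra.toSubmodule (coinv δ)) (LinearMap.id - g ∘ₗ D)
    fun p => (hmem _).2 (by simp [hDg]), fun b => Subtype.ext ?_, fun t ht => ?_⟩
  · change (b : P) - g (D b) = b
    rw [(hmem b).1 b.2, map_zero, sub_zero]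
  · have e1 : (coinv δ).val.toLinearMap ∘ₗ LinearMap.codRestrict
        (Subalgebra.toSubmodule (coinv δ)) (LinearMap.id - g ∘ₗ D)
        (fun p => (hmem _).2 (by simp [hDg])) = LinearMap.id - g ∘ₗ D := rfl
    have e2 : D.lTensor (coinv δ) t = 0 := by
      rw [hD, LinearMap.lTensor_sub, LinearMap.sub_apply, ht, sub_self]
    rw [e1, LinearMap.lTensor_sub, LinearMap.sub_apply, LinearMap.lTensor_comp,
      LinearMap.comp_apply, e2, map_zero, sub_zero, LinearMap.lTensor_id, LinearMap.id_apply]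

/-- A left `B`-linear retraction `P → B`. -/
theorem IsPrincipal.exists_linear_retraction {s : P →ₗ[coinv δ] coinv δ ⊗[k] P}
    (hs : IsColinear δ (freeCoact δ (coinv δ)) (s.restrictScalars k))
    (hms : coinvMul δ ∘ₗ s = LinearMap.id) : ∃ f : P →ₗ[coinv δ] coinv δ, f 1 = 1 := by
  obtain ⟨F, -, hF⟩ := hP.exists_retraction
  have hs1 : δ.lTensor _ (s 1) = ((TensorProduct.mk k P C).flip e).lTensor _ (s 1) := by
    have h1 := LinearMap.congr_fun hs 1
    simp only [LinearMap.comp_apply, LinearMap.restrictScalars_apply, hP.coaction_one,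
      LinearMap.rTensor_tmul, freeCoact, LinearEquiv.coe_coe] at h1
    rw [LinearEquiv.symm_apply_eq] at h1
    rw [h1]
    generalize s 1 = t
    induction t with
    | zero => simp
    | tmul a c => simp
    | add x y hx hy => simp only [map_add, TensorProduct.add_tmul, hx, hy]
  have e1 : ∀ t, ((coinvLift F t : coinv δ) : P) =
      coinvMul δ (((coinv δ).val.toLinearMap ∘ₗ F).lTensor _ t) := fun t => by
    induction t with
    | zero => simp
    | tmul a c => simp [coinvLift_tmul, coinvMul_tmul]
    | add x y hx hy => simp only [map_add, Subalgebra.coe_add, hx, hy]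
  refine ⟨coinvLift F ∘ₗ s, Subtype.ext ?_⟩
  rw [LinearMap.comp_apply, e1, hF _ hs1]
  exact LinearMap.congr_fun hms 1

/-- A right colinear map `β : C → P` with `β(e) = 1`, namely `β(c) = F(c^{<1>}) c^{<2>}` for the
lifting `c^{<1>} ⊗ c^{<2>}` of the translation map given by a section and a `k`-linear retraction
`F : P → B`. -/
theorem IsPrincipal.exists_total_integral {s : P →ₗ[coinv δ] coinv δ ⊗[k] P}
    (hs : IsColinear δ (freeCoact δ (coinv δ)) (s.restrictScalars k))
    (hms : coinvMul δ ∘ₗ s = LinearMap.id) :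
    ∃ β : C →ₗ[k] P, IsColinear (Coalgebra.comul (R := k)) δ β ∧ β e = 1 := by
  obtain ⟨F, hF, -⟩ := hP.exists_retraction
  have hσ := section_rTensor_mul s
  let m : P ⊗[k] P →ₗ[k] P := LinearMap.mul' k P ∘ₗ ((coinv δ).val.toLinearMap ∘ₗ F).rTensor P
  have hm : δ ∘ₗ m = m.rTensor C ∘ₗ (TensorProduct.assoc k P P C).symm.toLinearMap ∘ₗ
      δ.lTensor P := by
    refine TensorProduct.ext' fun p q => ?_
    have hq : δ ((coinv δ).val.toLinearMap (F p) * q) = _ := (F p).2 q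
    simp only [m, LinearMap.comp_apply, LinearMap.rTensor_tmul, LinearMap.mul'_apply,
      LinearMap.lTensor_tmul, LinearEquiv.coe_coe]
    rw [hq]
    generalize δ q = t
    induction t with
    | zero => simp
    | tmul a c => simp
    | add x y hx hy => simp only [map_add, TensorProduct.tmul_add, hx, hy]
  refine ⟨m ∘ₗ connection hP.galois _ hσ, ?_, ?_⟩
  · have h1 := connection_right_colinear hP.galois hσ hP.coaction (section_rTensor_colinear hs)
    unfold IsColinear
    rw [LinearMap.rTensor_comp, ← LinearMap.comp_assoc, hm, LinearMap.comp_assoc,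
      LinearMap.comp_assoc, h1]
    ext c
    simp only [LinearMap.comp_apply, LinearEquiv.coe_coe, LinearEquiv.symm_apply_apply]
  · have h1 : ∀ t, m ((coinv δ).val.toLinearMap.rTensor P t) = coinvMul δ t := fun t => by
      induction t with
      | zero => simp
      | tmul a c => simp [m, coinvMul_tmul, hF]
      | add x y hx hy => simp only [map_add, hx, hy]
    rw [LinearMap.comp_apply, connection_groupLike hσ hP]
    exact (h1 (s 1)).trans (LinearMap.congr_fun hms 1)

omit hP in
/-- The map `p ↦ f(p₍₀₎) ⊗ β(p₍₁₎)` is left `B`-linear and right colinear. -/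
theorem exists_colinear_of_retraction (hδ : IsRightCoaction δ) (f : P →ₗ[coinv δ] coinv δ)
    {β : C →ₗ[k] P} (hβ : IsColinear (Coalgebra.comul (R := k)) δ β) :
    ∃ g : P →ₗ[coinv δ] coinv δ ⊗[k] P,
      IsColinear δ (freeCoact δ (coinv δ)) (g.restrictScalars k) ∧
      ∀ p, g p = TensorProduct.map (f.restrictScalars k) β (δ p) := by
  let δB : P →ₗ[coinv δ] P ⊗[k] C := { δ with map_smul' := coaction_smul }
  refine ⟨TensorProduct.AlgebraTensorModule.map f β ∘ₗ δB, ?_, fun p => rfl⟩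
  let fk : P →ₗ[k] coinv δ := f.restrictScalars k
  have e1 : (TensorProduct.AlgebraTensorModule.map f β ∘ₗ δB).restrictScalars k =
    TensorProduct.map fk β ∘ₗ δ := rfl
  have e2 : freeCoact δ (coinv δ) ∘ₗ TensorProduct.map fk β =
      (TensorProduct.map fk β).rTensor C ∘ₗ (TensorProduct.assoc k P C C).symm.toLinearMap ∘ₗ
        (Coalgebra.comul (R := k)).lTensor P := by
    refine TensorProduct.ext' fun p c => ?_
    have h1 := LinearMap.congr_fun hβ c
    simp only [freeCoact, LinearMap.comp_apply, TensorProduct.map_tmul, LinearMap.lTensor_tmul,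
      LinearEquiv.coe_coe] at h1 ⊢
    rw [h1]
    generalize Coalgebra.comul (R := k) c = t
    induction t with
    | zero => simp
    | tmul a c => simp
    | add x y hx hy => simp only [map_add, TensorProduct.tmul_add, hx, hy]
  unfold IsColinear
  rw [e1, ← LinearMap.comp_assoc, e2, LinearMap.comp_assoc, LinearMap.comp_assoc, ← hδ.coassoc,
    LinearMap.rTensor_comp]
  ext p
  simp only [LinearMap.comp_apply, LinearEquiv.coe_coe, LinearEquiv.symm_apply_apply]

/-- The multiplication `B ⊗ P → P` has a left `B`-linear right colinear section `s` with
`s(1) = 1 ⊗ 1`. -/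
theorem IsPrincipal.exists_unital_section :
    ∃ s : P →ₗ[coinv δ] coinv δ ⊗[k] P,
      IsColinear δ (freeCoact δ (coinv δ)) (s.restrictScalars k) ∧
      coinvMul δ ∘ₗ s = LinearMap.id ∧ s 1 = 1 ⊗ₜ 1 := by
  obtain ⟨s, hs, hms⟩ := exists_section hP.coaction hP.projective
  obtain ⟨f, hf⟩ := hP.exists_linear_retraction hs hms
  obtain ⟨β, hβ, hβe⟩ := hP.exists_total_integral hs hms
  obtain ⟨g, hg, hgp⟩ := exists_colinear_of_retraction hP.coaction f hβ
  have hg1 : g 1 = 1 ⊗ₜ 1 := by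
    rw [hgp, hP.coaction_one, TensorProduct.map_tmul, LinearMap.restrictScalars_apply, hf, hβe]
  -- `g` has the right value at `1` but need not be a section; it is corrected by means of `s`
  refine ⟨g + s - s ∘ₗ coinvMul δ ∘ₗ g,
    (hg.restrictScalars_add hs).restrictScalars_sub (hs.comp (coinvMul_colinear.comp hg)), ?_, ?_⟩
  · rw [LinearMap.comp_sub, LinearMap.comp_add, ← LinearMap.comp_assoc, hms, LinearMap.id_comp]
    abel
  · have : coinvMul δ (g 1) = 1 := by rw [hg1, coinvMul_tmul]; simp
    simp only [LinearMap.sub_apply, LinearMap.add_apply, LinearMap.comp_apply, this]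
    rw [hg1, add_sub_cancel_right]

/-- The strong connection `c ↦ c^{[1]} s(c^{[2]})` of a unital section `s`. -/
theorem IsPrincipal.exists_strongConnection :
    ∃ l : C →ₗ[k] P ⊗[k] P, IsStrongConnection hP l := by
  obtain ⟨s, hs, hms, hs1⟩ := hP.exists_unital_section
  have hσ := section_rTensor_mul s
  refine ⟨connection hP.galois _ hσ, connection_lift _ _ fun p => ?_,
    connection_right_colinear _ _ hP.coaction (section_rTensor_colinear hs),
    connection_left_colinear _ _ fun p => ⟨s p, rfl⟩, ?_⟩
  · have h1 := LinearMap.congr_fun hms p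
    rw [LinearMap.comp_apply, LinearMap.id_apply] at h1
    conv_rhs => rw [← h1]
    rw [LinearMap.comp_apply, LinearMap.restrictScalars_apply]
    generalize s p = t
    induction t with
    | zero => simp
    | tmul b p =>
      rw [coinvMul_tmul, LinearMap.rTensor_tmul, Submodule.mkQ_apply, Submodule.mkQ_apply,
        Submodule.Quotient.eq]
      exact Submodule.subset_span ⟨1, p, b, b.2, by simp⟩
    | add x y hx hy => simp only [map_add, TensorProduct.tmul_add, hx, hy]
  · rw [connection_groupLike _ hP, LinearMap.comp_apply, LinearMap.restrictScalars_apply, hs1]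
    simp

end Sections

/-! ### The dual basis of the module of colinear maps -/

section Coefficients

variable {k : Type uk} [Field k] {C : Type uC} [AddCommGroup C] [Module k C] [Coalgebra k C]
  (V : FinCorep.{uk, uC, w} k C) {d : ℕ} (b : Module.Basis (Fin d) k V.carrier)

/-- The matrix coefficients `eᵢⱼ ∈ C` of a corepresentation, where `φ(eⱼ) = ∑ eᵢ ⊗ eᵢⱼ`. -/
noncomputable def FinCorep.coeff (i j : Fin d) : C :=
  TensorProduct.lid k C ((b.coord i).rTensor C (V.coact (b j)))

theorem FinCorep.character_eq : V.character b = ∑ i, V.coeff b i i := rfl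

theorem sum_basis_tmul {W : Type*} [AddCommGroup W] [Module k W] (t : V.carrier ⊗[k] W) :
    ∑ i, b i ⊗ₜ TensorProduct.lid k W ((b.coord i).rTensor W t) = t := by
  induction t with
  | zero => simp
  | tmul x c =>
    simp only [LinearMap.rTensor_tmul, TensorProduct.lid_tmul, Module.Basis.coord_apply,
      ← TensorProduct.smul_tmul, ← TensorProduct.sum_tmul, b.sum_repr]
  | add x y hx hy => simp only [map_add, TensorProduct.tmul_add, Finset.sum_add_distrib, hx, hy]

theorem FinCorep.coact_basis (j : Fin d) : V.coact (b j) = ∑ i, b i ⊗ₜ V.coeff b i j :=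
  (sum_basis_tmul V b _).symm

theorem FinCorep.comul_coeff (i j : Fin d) :
    Coalgebra.comul (R := k) (V.coeff b i j) = ∑ l, V.coeff b i l ⊗ₜ[k] V.coeff b l j := by
  have h := LinearMap.congr_fun V.isRightCoaction.coassoc (b j)
  simp only [LinearMap.comp_apply, LinearEquiv.coe_coe, V.coact_basis, map_sum,
    LinearMap.rTensor_tmul, LinearMap.lTensor_tmul, TensorProduct.sum_tmul,
    TensorProduct.assoc_tmul] at h
  have h2 := congrArg (fun t => TensorProduct.lid k (C ⊗[k] C) ((b.coord i).rTensor _ t)) h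
  simpa [Finsupp.single_apply, ite_smul] using h2.symm

theorem FinCorep.counit_coeff (i j : Fin d) :
    Coalgebra.counit (R := k) (V.coeff b i j) = if i = j then 1 else 0 := by
  have h := LinearMap.congr_fun V.isRightCoaction.counit (b j)
  simp only [LinearMap.comp_apply, LinearEquiv.coe_coe, V.coact_basis, map_sum,
    LinearMap.lTensor_tmul, TensorProduct.rid_tmul, LinearMap.id_apply] at h
  have h2 := congrArg (b.coord i) h
  simpa [Finsupp.single_apply, eq_comm] using h2

variable {P : Type uP} [Ring P] [Algebra k P] {δ : P →ₗ[k] P ⊗[k] C}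

variable {V b} in
theorem coaction_apply_basis {f : V.carrier →ₗ[k] P} (hf : IsColinear V.coact δ f) (j : Fin d) :
    δ (f (b j)) = ∑ i, f (b i) ⊗ₜ V.coeff b i j := by
  have := LinearMap.congr_fun hf (b j)
  simpa [V.coact_basis] using this

/-- The colinear map `V → C → P`, `eⱼ ↦ eᵢⱼ ↦ r(eᵢⱼ)`. -/
noncomputable def rowHom {r : C →ₗ[k] P} (hr : IsColinear (Coalgebra.comul (R := k)) δ r)
    (i : Fin d) : colinearHom δ V :=
  ⟨b.constr k fun j => r (V.coeff b i j), b.ext fun j => by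
    have := LinearMap.congr_fun hr (V.coeff b i j)
    simp only [LinearMap.comp_apply] at this
    simp [V.coact_basis, this, V.comul_coeff]⟩

theorem rowHom_basis {r : C →ₗ[k] P} (hr : IsColinear (Coalgebra.comul (R := k)) δ r)
    (i j : Fin d) : (rowHom V b hr i : V.carrier →ₗ[k] P) (b j) = r (V.coeff b i j) := by
  simp [rowHom]

end Coefficients

section LinearIndependent

variable {K : Type*} [Field K] {H W Y : Type*} [AddCommGroup H] [Module K H] [AddCommGroup W]
  [Module K W] [AddCommGroup Y] [Module K Y]

/-- Coefficients of linearly independent vectors in a tensor product can be compared after applying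
a separating family of linear maps to the vectors. -/
theorem eq_of_sum_tmul_eq {ι J : Type*} [Fintype ι] {ev : J → H →ₗ[K] W}
    (hev : ∀ f, (∀ j, ev j f = 0) → f = 0) {y : ι → H} (hy : LinearIndependent K y)
    {X X' : ι → Y} (h : ∀ j, ∑ a, X a ⊗ₜ[K] ev j (y a) = ∑ a, X' a ⊗ₜ[K] ev j (y a)) (a : ι) :
    X a = X' a := by
  rw [← sub_eq_zero, ← Module.forall_dual_apply_eq_zero_iff K]
  intro φ
  refine Fintype.linearIndependent_iff.1 hy (fun a => φ (X a - X' a)) (hev _ fun j => ?_) a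
  have h1 := congrArg (fun t => TensorProduct.lid K W (φ.rTensor W t)) (h j)
  simp only [map_sum, LinearMap.rTensor_tmul, TensorProduct.lid_tmul] at h1
  simp only [map_sum, map_smul, map_sub, sub_smul, Finset.sum_sub_distrib, h1, sub_self]

end LinearIndependent

section DualBasis

variable {k : Type uk} [Field k] {C : Type uC} [AddCommGroup C] [Module k C] [Coalgebra k C]
  {P : Type uP} [Ring P] [Algebra k P] {δ : P →ₗ[k] P ⊗[k] C}
  {l : C →ₗ[k] P ⊗[k] P}

/-- The second legs of a right colinear map `C → P ⊗ P` are right colinear. -/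
theorem leg_colinear (hl : δ.lTensor P ∘ₗ l =
      (TensorProduct.assoc k P P C).toLinearMap ∘ₗ l.rTensor C ∘ₗ Coalgebra.comul (R := k))
    (φ : P →ₗ[k] k) : IsColinear (Coalgebra.comul (R := k)) δ
      ((TensorProduct.lid k P).toLinearMap ∘ₗ φ.rTensor P ∘ₗ l) := by
  have e1 : δ ∘ₗ (TensorProduct.lid k P).toLinearMap ∘ₗ φ.rTensor P =
      (TensorProduct.lid k (P ⊗[k] C)).toLinearMap ∘ₗ φ.rTensor (P ⊗[k] C) ∘ₗ δ.lTensor P :=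
    TensorProduct.ext' fun p q => by simp
  have e2 : ∀ t, TensorProduct.lid k (P ⊗[k] C) (φ.rTensor (P ⊗[k] C)
      (TensorProduct.assoc k P P C t)) =
      ((TensorProduct.lid k P).toLinearMap ∘ₗ φ.rTensor P).rTensor C t := fun t => by
    induction t with
    | zero => simp
    | tmul x c =>
      induction x with
      | zero => simp
      | tmul p q => simp [TensorProduct.smul_tmul']
      | add x y hx hy => simp only [map_add, TensorProduct.add_tmul, hx, hy]
    | add x y hx hy => simp only [map_add, hx, hy]
  ext c
  have h1 := LinearMap.congr_fun hl c
  have h2 := LinearMap.congr_fun e1 (l c)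
  simp only [LinearMap.comp_apply, LinearEquiv.coe_coe] at h1 h2
  simp only [LinearMap.comp_apply, LinearEquiv.coe_coe]
  rw [h2, h1, e2, ← LinearMap.comp_apply, ← LinearMap.rTensor_comp]
  rfl

variable (V : FinCorep.{uk, uC, w} k C) {d : ℕ} (b : Module.Basis (Fin d) k V.carrier)

/-- The `k`-vector space underlying `Hom^C(V, P)`. -/
def colinearSpace (δ : P →ₗ[k] P ⊗[k] C) : Submodule k (V.carrier →ₗ[k] P) where
  carrier := {f | IsColinear V.coact δ f}
  add_mem' := (colinearHom δ V).add_mem'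
  zero_mem' := (colinearHom δ V).zero_mem'
  smul_mem' r f hf := by
    have e : r • f = algebraMap k (coinv δ) r • f := by
      ext; simp
    rw [e]
    exact (colinearHom δ V).smul_mem' _ hf

/-- The values of `ℓ` on the matrix coefficients factor through finitely many linearly independent
colinear maps `y_a : V → P`: `ℓ(eᵢⱼ) = ∑ qᵢₐ ⊗ yₐ(eⱼ)`. -/
theorem exists_connection_coeff (hl : δ.lTensor P ∘ₗ l =
      (TensorProduct.assoc k P P C).toLinearMap ∘ₗ l.rTensor C ∘ₗ Coalgebra.comul (R := k)) :
    ∃ (N : ℕ) (q : Fin d → Fin N → P) (y : Fin N → colinearHom δ V), 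
      LinearIndependent k (fun a => (y a : V.carrier →ₗ[k] P)) ∧
      ∀ i j, l (V.coeff b i j) = ∑ a, q i a ⊗ₜ (y a : V.carrier →ₗ[k] P) (b j) := by
  classical
  let W := Module.Basis.ofVectorSpace k P
  let H := colinearSpace V δ
  let ev : Fin d → H →ₗ[k] P := fun j => LinearMap.applyₗ (b j) ∘ₗ H.subtype
  have h1 : ∀ i, ∃ L : P ⊗[k] H, ∀ j, (ev j).lTensor P L = l (V.coeff b i j) := by
    intro i
    let c := fun j => TensorProduct.equivFinsuppOfBasisLeft W (l (V.coeff b i j))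
    -- finitely many basis vectors of `P` suffice for all `j`
    refine ⟨∑ ν ∈ Finset.univ.biUnion fun j => (c j).support,
      W ν ⊗ₜ ⟨rowHom V b (leg_colinear hl (W.coord ν)) i,
        (rowHom V b (leg_colinear hl (W.coord ν)) i).2⟩, fun j => ?_⟩
    have h2 : (c j).sum (fun ν p => W ν ⊗ₜ[k] p) = l (V.coeff b i j) := by
      rw [← TensorProduct.equivFinsuppOfBasisLeft_symm_apply]
      exact LinearEquiv.symm_apply_apply _ _
    rw [← h2, Finsupp.sum_of_support_subset _
      (Finset.subset_biUnion_of_mem (fun j => (c j).support) (Finset.mem_univ j)) _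
      (fun _ _ => TensorProduct.tmul_zero _ _), map_sum]
    refine Finset.sum_congr rfl fun ν _ => ?_
    rw [LinearMap.lTensor_tmul]
    congr 1
    refine (rowHom_basis V b (leg_colinear hl (W.coord ν)) i j).trans ?_
    simp only [c, TensorProduct.equivFinsuppOfBasisLeft_apply]
    rfl
  choose L hL using h1
  -- all rows at once, so that expanding in a basis of `Hom^C(V, P)` gives the same `yₐ` for
  -- each `i`
  let L' : (Fin d → P) ⊗[k] H := ∑ i, (LinearMap.single k (fun _ => P) i).rTensor H (L i)
  have hL' : ∀ i j, TensorProduct.map (LinearMap.proj i) (ev j) L' = l (V.coeff b i j) := by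
    intro i j
    rw [map_sum, Finset.sum_eq_single i, ← hL]
    · rw [← LinearMap.comp_apply, LinearMap.rTensor, ← TensorProduct.map_comp, LinearMap.comp_id]
      congr 2
      ext; simp
    · intro i' _ hi
      rw [← LinearMap.comp_apply, LinearMap.rTensor, ← TensorProduct.map_comp]
      have : LinearMap.proj i ∘ₗ LinearMap.single k (fun _ : Fin d => P) i' = 0 := by
        ext; simp [hi.symm]
      rw [this, TensorProduct.map_zero_left, LinearMap.zero_apply]
    · simp
  let 𝒞 := Module.Basis.ofVectorSpace k H
  obtain ⟨c, hc⟩ := TensorProduct.eq_repr_basis_right 𝒞 L'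
  let ε := c.support.equivFin
  refine ⟨_, fun i a => c (ε.symm a) i, fun a => ⟨𝒞 (ε.symm a), (𝒞 (ε.symm a)).2⟩,
    (𝒞.linearIndependent.map' H.subtype H.ker_subtype).comp _
      (Subtype.val_injective.comp ε.symm.injective), fun i j => ?_⟩
  rw [← hL', ← hc, Finsupp.sum, map_sum, ← Finset.sum_coe_sort, ← ε.symm.sum_comp]
  rfl

variable {e : C} {hP : IsPrincipal δ e} (hl : IsStrongConnection hP l)
include hl

/-- `c^{<1>} c^{<2>} = ε(c)`, from counitality of the coaction. -/
theorem IsStrongConnection.mul_apply (c : C) :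
    LinearMap.mul' k P (l c) = algebraMap k P (Coalgebra.counit (R := k) c) := by
  have h1 : freeLift δ (l c) = 1 ⊗ₜ c := by
    rw [← can_mkQ, ← can_translation hP.galois, ← hl.lift]
    rfl
  have h2 : ∀ t, TensorProduct.rid k P ((Coalgebra.counit (R := k)).lTensor P (freeLift δ t)) =
      LinearMap.mul' k P t := fun t => by
    induction t with
    | zero => simp
    | tmul p q =>
      have := LinearMap.congr_fun hP.coaction.counit q
      simp only [LinearMap.comp_apply, LinearEquiv.coe_coe, LinearMap.id_apply] at this
      rw [freeLift_tmul, LinearMap.mul'_apply]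
      conv_rhs => rw [← this]
      generalize δ q = t
      induction t with
      | zero => simp
      | tmul a c => simp
      | add x y hx hy => simp only [map_add, mul_add, hx, hy]
    | add x y hx hy => simp only [map_add, hx, hy]
  rw [← h2, h1]
  simp [Algebra.algebraMap_eq_smul_one]

variable {V b} {ι : Type*} [Fintype ι] {q : Fin d → ι → P} {y : ι → colinearHom δ V}
  (hy : LinearIndependent k fun a => (y a : V.carrier →ₗ[k] P))
  (hq : ∀ i j, l (V.coeff b i j) = ∑ a, q i a ⊗ₜ (y a : V.carrier →ₗ[k] P) (b j))
include hy hq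

/-- Left colinearity of `ℓ`, read off on the linearly independent second legs. -/
theorem IsStrongConnection.sum_entwining_coeff (i : Fin d) (a : ι) :
    ∑ j, entwining hP.galois (V.coeff b i j ⊗ₜ q j a) = q i a ⊗ₜ e := by
  refine eq_of_sum_tmul_eq (ev := fun j => LinearMap.applyₗ (b j)) (fun f hf => b.ext hf) hy
    (X := fun a => ∑ j, entwining hP.galois (V.coeff b i j ⊗ₜ q j a))
    (X' := fun a => q i a ⊗ₜ e) (fun m => ?_) a
  have h := LinearMap.congr_fun ((left_colinear_iff hP l).1 hl.left_colinear) (V.coeff b i m)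
  simp only [LinearMap.comp_apply, LinearEquiv.coe_coe, V.comul_coeff, map_sum,
    LinearMap.lTensor_tmul, hq, TensorProduct.tmul_sum, TensorProduct.assoc_symm_tmul,
    LinearMap.rTensor_tmul, LinearMap.flip_apply, TensorProduct.mk_apply] at h
  simp only [TensorProduct.sum_tmul]
  rw [Finset.sum_comm]
  exact h

theorem IsStrongConnection.sum_mul_mem_coinv {f : V.carrier →ₗ[k] P}
    (hf : IsColinear V.coact δ f) (a : ι) : ∑ j, f (b j) * q j a ∈ coinv δ := by
  rw [hP.mem_coinv_iff]
  simp only [map_sum, coaction_mul hP.galois, coaction_apply_basis hf, entwinedAct_tmul]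
  rw [Finset.sum_comm]
  simp only [← map_sum, hl.sum_entwining_coeff hy hq]
  simp [TensorProduct.sum_tmul]

/-- The dual basis of `Hom^C(V, P)` given by the maps `yₐ` and the functionals
`f ↦ ∑ f(eⱼ) qⱼₐ`, where `ℓ(eᵢⱼ) = ∑ qᵢₐ ⊗ yₐ(eⱼ)`. -/
noncomputable def IsStrongConnection.dualBasis : DualBasis (coinv δ) ι (colinearHom δ V) where
  x := y
  f a :=
    { toFun := fun f => ⟨∑ j, (f : V.carrier →ₗ[k] P) (b j) * q j a,
        hl.sum_mul_mem_coinv hy hq f.2 a⟩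
      map_add' := fun f g => Subtype.ext <| by simp [add_mul, Finset.sum_add_distrib]
      map_smul' := fun c f => Subtype.ext <| by
        simp [Subalgebra.smul_def, mul_assoc, Finset.mul_sum] }
  sum_eq f := Subtype.ext <| b.ext fun m => by
    have h : ∀ j, ∑ a, q j a * (y a : V.carrier →ₗ[k] P) (b m) = if j = m then 1 else 0 := by
      intro j
      have := hl.mul_apply (V.coeff b j m)
      rw [hq, V.counit_coeff] at this
      simpa [apply_ite (algebraMap k P)] using this
    have h2 : ((∑ a, (⟨∑ j, (f : V.carrier →ₗ[k] P) (b j) * q j a,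
        hl.sum_mul_mem_coinv hy hq f.2 a⟩ : coinv δ) • y a : colinearHom δ V) :
          V.carrier →ₗ[k] P) (b m) =
        ∑ a, (∑ j, (f : V.carrier →ₗ[k] P) (b j) * q j a) * (y a : V.carrier →ₗ[k] P) (b m) := by
      simp [Subalgebra.smul_def]
    refine h2.trans ?_
    simp only [Finset.sum_mul, mul_assoc]
    rw [Finset.sum_comm]
    simp [← Finset.mul_sum, h]

end DualBasis

/-! ### The chain of a comultiplicative matrix -/

section Chain

variable {k : Type uk} [Field k] {C : Type uC} [AddCommGroup C] [Module k C] [Coalgebra k C]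
  {P : Type uP} [Ring P] [Algebra k P] {l : C →ₗ[k] P ⊗[k] P} {J ι : Type*} [Fintype J]
  [Fintype ι] {c : J → J → C} {q : J → ι → P} {y : ι → J → P}
  (hc : ∀ i j, Coalgebra.comul (R := k) (c i j) = ∑ s, c i s ⊗ₜ[k] c s j)
  (hl : ∀ i j, l (c i j) = ∑ a, q i a ⊗ₜ y a j)
include hc hl

/-- If `ℓ(cᵢⱼ) = ∑ qᵢₐ ⊗ yₐⱼ` on a comultiplicative matrix `c`, then the inner legs of the iterated
gluing of `ℓ` are the entries of the matrix product `E = y q`. -/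
theorem strand_comulMatrix (m : ℕ) (i j : J) :
    strand l m (c i j) = ∑ α : Fin (m + 1) → ι,
      (q i (α 0) ⊗ₜ PiTensorProduct.tprod k fun t : Fin m =>
        (Matrix.of y * Matrix.of q) (α t.castSucc) (α t.succ)) ⊗ₜ y (α (Fin.last m)) j := by
  induction m generalizing i j with
  | zero =>
    rw [strand, LinearMap.comp_apply, hl, map_sum]
    refine Fintype.sum_equiv (Equiv.funUnique (Fin 1) ι).symm _ _ fun a => ?_
    simp only [LinearMap.rTensor_tmul, LinearMap.flip_apply, TensorProduct.mk_apply]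
    congr 3
    exact Subsingleton.elim (α := Fin 0 → P) _ _
  | succ m ih =>
    rw [strand, LinearMap.comp_apply, LinearMap.comp_apply, hc]
    simp only [map_sum, TensorProduct.map_tmul, ih, hl, TensorProduct.sum_tmul,
      TensorProduct.tmul_sum, joinTens_tmul]
    rw [← (Fin.snocEquiv fun _ : Fin (m + 2) => ι).sum_comp, Fintype.sum_prod_type,
      Finset.sum_comm]
    refine Finset.sum_congr rfl fun a _ => ?_
    rw [Finset.sum_comm]
    refine Finset.sum_congr rfl fun α _ => ?_
    have h1 : (Matrix.of y * Matrix.of q) (α (Fin.last m)) a =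
      ∑ s, y (α (Fin.last m)) s * q s a := Matrix.mul_apply
    have h2 : ∀ t : Fin (m + 1), (Fin.snocEquiv fun _ : Fin (m + 2) => ι) (a, α) t.castSucc = α t :=
      fun t => Fin.snoc_castSucc (α := fun _ => ι) a α t
    have h3 : (Fin.snocEquiv fun _ : Fin (m + 2) => ι) (a, α) (Fin.last (m + 1)) = a :=
      Fin.snoc_last (α := fun _ => ι) a α
    have h4 := h2 0
    rw [Fin.castSucc_zero] at h4
    rw [h3, h4, ← TensorProduct.sum_tmul, ← TensorProduct.tmul_sum, ← map_sum, ← h1,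
      snocTens_tprod]
    congr 3
    funext t
    rw [h2]
    refine Fin.lastCases ?_ (fun t => ?_) t
    · rw [Fin.snoc_last, Fin.succ_last, h3]
    · rw [Fin.snoc_castSucc, Fin.succ_castSucc, h2]

/-- Closing up the strands: the chain of the trace of `c` is the generalized trace of `y q`. -/
theorem galoisChain_comulMatrix (m : ℕ) :
    galoisChain l m (∑ i, c i i) = ∑ p : Fin (m + 1) → ι,
      PiTensorProduct.tprod k fun j => (Matrix.of y * Matrix.of q) (p j) (p (j + 1)) := by
  rw [galoisChain, LinearMap.comp_apply, map_sum, map_sum]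
  simp only [strand_comulMatrix hc hl, map_sum, closeTens_tmul]
  rw [Finset.sum_comm]
  refine Fintype.sum_equiv (Equiv.arrowCongr (finRotate (m + 1)) (Equiv.refl ι)) _ _ fun α => ?_
  have h1 : (Matrix.of y * Matrix.of q) (α (Fin.last m)) (α 0) =
    ∑ i, y (α (Fin.last m)) i * q i (α 0) := Matrix.mul_apply
  simp only [← LinearMap.sum_apply, ← map_sum, ← h1]
  rw [consTens_tprod]
  congr 1
  have h2 : ∀ j, Equiv.arrowCongr (finRotate (m + 1)) (Equiv.refl ι) α (j + 1) = α j := fun j => by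
    rw [← finRotate_apply]; simp
  funext j
  rw [h2]
  refine Fin.cases ?_ (fun t => ?_) j
  · rw [Fin.cons_zero, ← h2 (Fin.last m), Fin.last_add_one]
  · rw [Fin.cons_succ, ← h2 t.castSucc, Fin.coeSucc_eq_succ]

end Chain

/-! ### The map on classes and the Chern–Galois character -/

section DualBasisFinite

variable {B : Type*} [Ring B] {ι : Type*} [Fintype ι] {M : Type*} [AddCommGroup M] [Module B M]

theorem DualBasis.finite (D : DualBasis B ι M) : Module.Finite B M :=
  Module.Finite.of_surjective (Fintype.linearCombination B D.x) fun m =>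
    ⟨fun i => D.f i m, by rw [Fintype.linearCombination_apply, D.sum_eq]⟩

theorem DualBasis.projective (D : DualBasis B ι M) : Module.Projective B M :=
  Module.Projective.of_split (LinearMap.pi D.f) (Fintype.linearCombination B D.x) <|
    LinearMap.ext fun m => by
      rw [LinearMap.comp_apply, Fintype.linearCombination_apply]
      exact D.sum_eq m

end DualBasisFinite

section ColinearHom

variable {k : Type uk} [Field k] {C : Type uC} [AddCommGroup C] [Module k C] [Coalgebra k C]
  {P : Type uP} [Ring P] [Algebra k P] {δ : P →ₗ[k] P ⊗[k] C}

/-- Over a field a `k`-linear retraction `P → B` splits `B^{⊗m} → P^{⊗m}`. -/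
theorem inclTens_injective (B : Subalgebra k P) (m : ℕ) : Function.Injective (inclTens B m) := by
  obtain ⟨g, hg⟩ := B.val.toLinearMap.exists_leftInverse_of_injective
    (LinearMap.ker_eq_bot.2 Subtype.val_injective)
  refine Function.LeftInverse.injective (g := PiTensorProduct.map fun _ => g) fun t => ?_
  rw [inclTens, ← LinearMap.comp_apply, ← PiTensorProduct.map_comp]
  simp only [hg, PiTensorProduct.map_id, LinearMap.id_apply]

/-- Every strong connection gives a finite dual basis of `Hom^C(V, P)` whose idempotent matrix has
the Chern–Galois chain of the character as its generalized trace. -/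
theorem IsStrongConnection.exists_dualBasis {e : C} {hP : IsPrincipal δ e} {l : C →ₗ[k] P ⊗[k] P}
    (hl : IsStrongConnection hP l) (V : FinCorep.{uk, uC, w} k C) {d : ℕ}
    (b : Module.Basis (Fin d) k V.carrier) :
    ∃ (N : ℕ) (D : DualBasis (coinv δ) (Fin N) (colinearHom δ V)), ∀ m,
      inclTens (coinv δ) (m + 1) (genTrace k m fun _ => D.matrix) =
        galoisChain l m (V.character b) := by
  obtain ⟨N, q, y, hy, hq⟩ := exists_connection_coeff V b hl.right_colinear
  refine ⟨N, hl.dualBasis hy hq, fun m => ?_⟩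
  rw [V.character_eq, galoisChain_comulMatrix (V.comul_coeff b) hq, genTrace_apply, map_sum]
  refine Finset.sum_congr rfl fun p _ => ?_
  rw [inclTens, PiTensorProduct.map_tprod]
  congr 1

theorem IsPrincipal.finite_projective {e : C} (hP : IsPrincipal δ e)
    (V : FinCorep.{uk, uC, w} k C) : Module.Finite (coinv δ) (colinearHom δ V) ∧
      Module.Projective (coinv δ) (colinearHom δ V) := by
  obtain ⟨l, hl⟩ := hP.exists_strongConnection
  obtain ⟨N, D, -⟩ := hl.exists_dualBasis V (Module.finBasis k V.carrier)
  exact ⟨D.finite, D.projective⟩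

/-- Isomorphic corepresentations have isomorphic modules of colinear maps. -/
def colinearHomCongr {V W : FinCorep.{uk, uC, w} k C} (f : V.carrier ≃ₗ[k] W.carrier)
    (hf : IsColinear V.coact W.coact f.toLinearMap) :
    colinearHom δ V ≃ₗ[coinv δ] colinearHom δ W where
  toFun g := ⟨(g : V.carrier →ₗ[k] P) ∘ₗ f.symm.toLinearMap, IsColinear.comp g.2 hf.symm⟩
  invFun g := ⟨(g : W.carrier →ₗ[k] P) ∘ₗ f.toLinearMap, IsColinear.comp g.2 hf⟩
  map_add' _ _ := rfl
  map_smul' _ _ := rfl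
  left_inv g := Subtype.ext <| by ext; simp
  right_inv g := Subtype.ext <| by ext; simp

/-- Colinear maps out of a direct sum. -/
noncomputable def colinearHomProd (V W : FinCorep.{uk, uC, w} k C) :
    colinearHom δ (V.prod W) ≃ₗ[coinv δ] colinearHom δ V × colinearHom δ W where
  toFun g :=
    (⟨g.1 ∘ₗ LinearMap.inl k V.carrier W.carrier,
        IsColinear.comp (δV := prodCoact V.coact W.coact) g.2 (inl_colinear V.coact W.coact)⟩,
      ⟨g.1 ∘ₗ LinearMap.inr k V.carrier W.carrier,
        IsColinear.comp (δV := prodCoact V.coact W.coact) g.2 (inr_colinear V.coact W.coact)⟩)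
  invFun g := ⟨(g.1 : V.carrier →ₗ[k] P).coprod (g.2 : W.carrier →ₗ[k] P),
    prod_colinear (by rw [LinearMap.coprod_inl]; exact g.1.2)
      (by rw [LinearMap.coprod_inr]; exact g.2.2)⟩
  map_add' _ _ := rfl
  map_smul' _ _ := rfl
  left_inv g := Subtype.ext <| LinearMap.prod_ext (LinearMap.coprod_inl _ _)
    (LinearMap.coprod_inr _ _)
  right_inv g := Prod.ext (Subtype.ext (LinearMap.coprod_inl _ _))
    (Subtype.ext (LinearMap.coprod_inr _ _))

/-- `[φ] ↦ [Hom^C(V_φ, P)]` on isomorphism classes. -/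
noncomputable def IsPrincipal.assocClass {e : C} (hP : IsPrincipal δ e) :
    CorepClass.{uk, uC, w} k C →+ ProjClass.{uP, max w uP} (coinv δ) where
  toFun := Quotient.lift (fun V => Quotient.mk _
      (@FGProj.mk _ _ (colinearHom δ V) _ _ (hP.finite_projective V).1 (hP.finite_projective V).2))
    fun _ _ ⟨f, hf⟩ => Quotient.sound ⟨colinearHomCongr f hf⟩
  map_zero' := by
    refine Quotient.sound ⟨?_⟩
    have h0 : Subsingleton (FinCorep.zero : FinCorep.{uk, uC, w} k C).carrier :=
      inferInstanceAs (Subsingleton PUnit)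
    have : Subsingleton (colinearHom δ (FinCorep.zero : FinCorep.{uk, uC, w} k C)) :=
      ⟨fun f g => Subtype.ext (LinearMap.ext fun x => by
        rw [h0.elim x 0, map_zero, map_zero])⟩
    exact ⟨0, 0, fun _ => Subsingleton.elim _ _, fun _ => rfl⟩
  map_add' := by
    rintro ⟨V⟩ ⟨W⟩
    exact Quotient.sound ⟨colinearHomProd V W⟩

end ColinearHom
end ChernGalois

open ChernGalois
theorem mainTheorem3 {k : Type uk} [Field k] [CharZero k]
    {C : Type uC} [AddCommGroup C] [Module k C] [Coalgebra k C]
    {P : Type uP} [Ring P] [Algebra k P]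
    (δ : P →ₗ[k] P ⊗[k] C) (e : C) (hP : IsPrincipal δ e) :
    ∃ assoc : CorepGroup.{uk, uC, w} k C →+ K0.{uP, max w uP} (coinv δ),
      -- `[φ] ↦ [Hom^C(V_φ, P)]`
      (∀ V : FinCorep.{uk, uC, w} k C,
        ∃ (_ : Module.Finite (coinv δ) (colinearHom δ V))
          (_ : Module.Projective (coinv δ) (colinearHom δ V)),
          assoc V.cls = K0.of (coinv δ) (colinearHom δ V)) ∧
      -- strong connections exist
      (∃ l : C →ₗ[k] P ⊗[k] P, IsStrongConnection hP l) ∧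
      -- the formula for `chg₂ₙ = ch₂ₙ ∘ assoc`, for every strong connection
      (∀ (n : ℕ) (V : FinCorep.{uk, uC, w} k C) (d : ℕ) (b : Module.Basis (Fin d) k V.carrier)
        (l : C →ₗ[k] P ⊗[k] P), IsStrongConnection hP l →
        ∃! z : Tens k (coinv δ) (2 * n + 1),
          inclTens (coinv δ) (2 * n + 1) z = galoisChain l (2 * n) (V.character b) ∧
          ∃ hz : z ∈ cycles k (coinv δ) (2 * n),
            ((chern (coinv δ) k n).comp assoc) V.cls = (-1 : k) ^ n • HC.mk k (coinv δ) z hz) ∧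
      -- the class in the formula does not depend on the strong connection
      (∀ (n : ℕ) (V : FinCorep.{uk, uC, w} k C) (d d' : ℕ)
        (b : Module.Basis (Fin d) k V.carrier) (b' : Module.Basis (Fin d') k V.carrier)
        (l l' : C →ₗ[k] P ⊗[k] P), IsStrongConnection hP l → IsStrongConnection hP l' →
        ∀ (z z' : Tens k (coinv δ) (2 * n + 1)) (hz : z ∈ cycles k (coinv δ) (2 * n))
          (hz' : z' ∈ cycles k (coinv δ) (2 * n)),
          inclTens (coinv δ) (2 * n + 1) z = galoisChain l (2 * n) (V.character b) →
          inclTens (coinv δ) (2 * n + 1) z' = galoisChain l' (2 * n) (V.character b') →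
          HC.mk k (coinv δ) z hz = HC.mk k (coinv δ) z' hz') := by
  have hassoc : ∀ V : FinCorep.{uk, uC, w} k C,
      ∃ (_ : Module.Finite (coinv δ) (colinearHom δ V))
        (_ : Module.Projective (coinv δ) (colinearHom δ V)),
        Algebra.GrothendieckAddGroup.lift ((Algebra.GrothendieckAddGroup.of
          (M := ProjClass.{uP, max w uP} (coinv δ))).comp hP.assocClass) V.cls =
            K0.of (coinv δ) (colinearHom δ V) := fun V =>
    ⟨(hP.finite_projective V).1, (hP.finite_projective V).2,
      DFunLike.congr_fun (Algebra.GrothendieckAddGroup.lift.symm_apply_apply _) _⟩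
  refine ⟨_, hassoc, hP.exists_strongConnection, fun n V d b l hl => ?_,
    fun n V d d' b b' l l' hl hl' z z' hz hz' h h' => ?_⟩
  · obtain ⟨N, D, hD⟩ := hl.exists_dualBasis V b
    refine ⟨genTrace k (2 * n) fun _ => D.matrix, ⟨hD _, genTrace_mem_cycles D.isIdempotentElem n,
      ?_⟩, fun z hz => inclTens_injective _ _ (hz.1.trans (hD _).symm)⟩
    obtain ⟨_, _, hV⟩ := hassoc V
    rw [AddMonoidHom.comp_apply, hV, chern_of, chernObj_eq _ _ _ D]
    rfl
  · obtain ⟨N, D, hD⟩ := hl.exists_dualBasis V b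
    obtain ⟨N', D', hD'⟩ := hl'.exists_dualBasis V b'
    obtain rfl := inclTens_injective _ _ (h.trans (hD _).symm)
    obtain rfl := inclTens_injective _ _ (h'.trans (hD' _).symm)
    rw [HC.mk_eq_mk]
    exact genTrace_sub_mem_boundaries (D'.mul_aux D.x D.f) (D.mul_aux D'.x D'.f)
      (D.mul_aux D.x D'.f) (D'.mul_aux D'.x D.f) n
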